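/- Let $A\in\mathbb{R}^{n\times n}$ have all its eigenvalues in the open unit disc, let $B\in\mathbb{R}^{n\times m}$ have full column rank, let $(A,B)$ be reachable, and let $G(z)=(zI-A)^{-1}B$. Let $\mathcal{S}_+^{m\times m}$ be the set of bounded and coercive spectral densities on the unit circle $\mathbb{T}$ of $\mathbb{R}^m$-valued processes, that is, of measurable $\Phi:\mathbb{T}\to\mathbb{C}^{m\times m}$ with $\Phi(\bar z)=\overline{\Phi(z)}$ and $\alpha I<\Phi(z)\le cI$ for almost every $z\in\mathbb{T}$, for some constants $\alpha,c>0$; put $G^*(z)=G(z^{-1})^\top$ (so $G^*(z)$ is the conjugate transpose of $G(z)$ on $\mathbb{T}$), and let $\Psi\in\mathcal{S}_+^{m\times m}$ be rational. The McMillan degree $\deg[M]$ of a (possibly improper) rational matrix $M$ is the number of its poles in $\mathbb{C}\cup\{\infty\}$ counted with multiplicity, the multiplicity of a pole being the highest order that it has as a pole of any minor of $M$. Then $\deg[G]=n$, and: (i) for every real symmetric $\Lambda\in\mathbb{R}^{n\times n}$ with $\Psi^{-1}+G^*\Lambda G>0$ almost everywhere on $\mathbb{T}$, the function $\Phi^\circ(\Lambda)=[\Psi^{-1}+G^*\Lambda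 G]^{-1}$ is (almost everywhere on $\mathbb{T}$ equal to) a rational matrix with $\deg[\Phi^\circ(\Lambda)]\le\deg[\Psi]+2n$; (ii) for every real symmetric $\Sigma>0$, every solution $\Phi^\circ$ of the spectrum approximation problem of minimizing $$d_{RER}(\Phi,\Psi)=\frac1{4\pi}\int_{-\pi}^{\pi}\Big\{\log\det\big(\Phi^{-1}\Psi\big)+\operatorname{tr}\big[\Psi^{-1}(\Phi-\Psi)\big]\Big\}(e^{j\vartheta})\,d\vartheta$$ over all $\Phi\in\mathcal{S}_+^{m\times m}$ with $\frac1{2\pi}\int_{-\pi}^{\pi}G\Phi G^*(e^{j\vartheta})\,d\vartheta=\Sigma$ is almost everywhere of the form $\Phi^\circ(\Lambda)$ for some $\Lambda$ as in (i), and is therefore (almost everywhere equal to) a rational matrix with $\deg[\Phi^\circ]\le\deg[\Psi]+2n$. -/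

import Mathlib

open scoped Matrix ComplexOrder
open MeasureTheory

noncomputable section

/-! ## McMillan degree of a rational matrix -/

/-- A choice of rows and columns (as many of each) in a `p × q` matrix. Non-injective choices
give a vanishing minor and permuted ones the same minor up to sign; the empty choice gives the
minor `1`. -/
abbrev MinorIndex (p q : ℕ) : Type :=
  Σ k : Fin (min p q + 1), (Fin k → Fin p) × (Fin k → Fin q)

/-- The minor of a rational matrix with the given rows and columns. -/
def ratMinor {p q : ℕ} (M : Matrix (Fin p) (Fin q) (RatFunc ℂ)) (s : MinorIndex p q) :
    RatFunc ℂ :=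
  (M.submatrix s.2.1 s.2.2).det

/-- Multiplicity of the finite point `a` as a pole of `M`: the highest order that `a` has as a
pole of a minor of `M`. -/
def poleMultiplicity {p q : ℕ} (M : Matrix (Fin p) (Fin q) (RatFunc ℂ)) (a : ℂ) : ℕ :=
  Finset.univ.sup fun s : MinorIndex p q => (ratMinor M s).denom.rootMultiplicity a

/-- Multiplicity of `∞` as a pole of `M`: the highest order that `∞` has as a pole of a minor
of `M`. -/
def poleMultiplicityInfty {p q : ℕ} (M : Matrix (Fin p) (Fin q) (RatFunc ℂ)) : ℕ :=
  Finset.univ.sup fun s : MinorIndex p q => (ratMinor M s).intDegree.toNat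

/-- McMillan degree of a (possibly improper) rational matrix: the number of its poles in
`ℂ ∪ {∞}`, counted with multiplicity. -/
def mcmillanDegree {p q : ℕ} (M : Matrix (Fin p) (Fin q) (RatFunc ℂ)) : ℕ :=
  (∑ᶠ a : ℂ, poleMultiplicity M a) + poleMultiplicityInfty M

/-- A rational matrix has finitely many poles, so the sum in its degree is a genuine one. -/
theorem poleMultiplicity_support_finite {p q : ℕ} (M : Matrix (Fin p) (Fin q) (RatFunc ℂ)) :
    (Function.support (poleMultiplicity M)).Finite := by
  classical
  refine (Finset.univ.biUnion fun s : MinorIndex p q =>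
    (ratMinor M s).denom.roots.toFinset).finite_toSet.subset ?_
  intro a ha
  by_contra h
  apply ha
  refine le_antisymm (Finset.sup_le fun s _ => ?_) (Nat.zero_le _)
  have h1 : a ∉ (ratMinor M s).denom.roots := fun h2 =>
    h (by
    rw [Finset.coe_biUnion]
    exact Set.mem_biUnion (Finset.mem_coe.2 (Finset.mem_univ s)) (by simpa using h2))
  rw [← Polynomial.count_roots]
  exact le_of_eq (Multiset.count_eq_zero.2 h1)

/-- The values on the unit circle of a rational matrix. -/
def onCircle {p q : ℕ} (M : Matrix (Fin p) (Fin q) (RatFunc ℂ)) (z : Circle) :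
    Matrix (Fin p) (Fin q) ℂ :=
  M.map (RatFunc.eval (RingHom.id ℂ) (z : ℂ))

/-! ## The filter -/

/-- The pair `(A, B)` defines a filter bank: `A` is a stability matrix, `B` has full column rank
(so `m ≤ n`), and `(A, B)` is reachable. -/
structure IsFilterBank {n m : ℕ} (A : Matrix (Fin n) (Fin n) ℝ) (B : Matrix (Fin n) (Fin m) ℝ) :
    Prop where
  stable : ∀ a : ℂ, (A.map Complex.ofReal).charpoly.IsRoot a → ‖a‖ < 1
  fullRank : B.rank = m
  reachable : Submodule.span ℝ
    (Set.range fun s : Fin n × Fin m => fun i => (A ^ (s.1 : ℕ) * B) i s.2) = ⊤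

/-- The transfer function `G(z) = (z I - A)⁻¹ B`. -/
def transferFunction {n m : ℕ} (A : Matrix (Fin n) (Fin n) ℝ) (B : Matrix (Fin n) (Fin m) ℝ) :
    Matrix (Fin n) (Fin m) (RatFunc ℂ) :=
  (Matrix.scalar (Fin n) RatFunc.X - A.map fun x => RatFunc.C (x : ℂ))⁻¹ *
    B.map fun x => RatFunc.C (x : ℂ)

/-! ## Spectral densities on the unit circle -/

/-- The property `P` holds for Lebesgue almost every point of the unit circle. -/
def AECircle (P : Circle → Prop) : Prop :=
  ∀ᵐ θ ∂(volume.restrict (Set.Ioc (-Real.pi) Real.pi)), P (Circle.exp θ)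

/-- Integral over the unit circle with respect to normalized Lebesgue measure. -/
def circleMean (f : Circle → ℂ) : ℂ :=
  (2 * (Real.pi : ℂ))⁻¹ * ∫ θ in (-Real.pi)..Real.pi, f (Circle.exp θ)

/-- The class of bounded and coercive spectral densities of `ℝ^m`-valued processes. The
symmetry `Φ (conj z) = conj (Φ z)` expresses that the process is real. -/
structure IsSpectralDensity {m : ℕ} (Φ : Circle → Matrix (Fin m) (Fin m) ℂ) : Prop where
  measurable : ∀ i j, AEMeasurable (fun θ : ℝ => Φ (Circle.exp θ) i j)
    (volume.restrict (Set.Ioc (-Real.pi) Real.pi))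
  real : AECircle fun z => Φ z⁻¹ = (Φ z).map (starRingEnd ℂ)
  bounded : ∃ c : ℝ, AECircle fun z =>
    ((c : ℂ) • (1 : Matrix (Fin m) (Fin m) ℂ) - Φ z).PosSemidef
  coercive : ∃ α : ℝ, 0 < α ∧ AECircle fun z =>
    (Φ z - (α : ℂ) • (1 : Matrix (Fin m) (Fin m) ℂ)).PosDef

/-- The relative entropy rate pseudo-distance between spectral densities. -/
def rerDist {m : ℕ} (Φ Ψ : Circle → Matrix (Fin m) (Fin m) ℂ) : ℝ :=
  (4 * Real.pi)⁻¹ * ∫ θ in (-Real.pi)..Real.pi,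
    (Real.log (((Φ (Circle.exp θ))⁻¹ * Ψ (Circle.exp θ)).det).re +
      (((Ψ (Circle.exp θ))⁻¹ * (Φ (Circle.exp θ) - Ψ (Circle.exp θ))).trace).re)

/-- The moment constraint `∫ G Φ G* = S`. -/
def MomentConstraint {n m : ℕ} (G : Circle → Matrix (Fin n) (Fin m) ℂ)
    (S : Matrix (Fin n) (Fin n) ℝ) (Φ : Circle → Matrix (Fin m) (Fin m) ℂ) : Prop :=
  ∀ i j, circleMean (fun z => (G z * Φ z * (G z)ᴴ) i j) = (S i j : ℂ)

/-- `Φ` solves the spectrum approximation problem: it minimizes `rerDist · Ψ` over the bounded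
and coercive spectral densities that satisfy the moment constraint. -/
structure IsOptimalApproximant {n m : ℕ} (G : Circle → Matrix (Fin n) (Fin m) ℂ)
    (S : Matrix (Fin n) (Fin n) ℝ) (Ψ Φ : Circle → Matrix (Fin m) (Fin m) ℂ) : Prop where
  spectral : IsSpectralDensity Φ
  moment : MomentConstraint G S Φ
  minimal : ∀ Φ' : Circle → Matrix (Fin m) (Fin m) ℂ, IsSpectralDensity Φ' →
    MomentConstraint G S Φ' → rerDist Φ Ψ ≤ rerDist Φ' Ψ

/-- The function `Ψ⁻¹ + G* Λ G` on the unit circle. -/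
def inverseApproximant {n m : ℕ} (G : Circle → Matrix (Fin n) (Fin m) ℂ)
    (Ψ : Circle → Matrix (Fin m) (Fin m) ℂ) (Λ : Matrix (Fin n) (Fin n) ℝ) (z : Circle) :
    Matrix (Fin m) (Fin m) ℂ :=
  (Ψ z)⁻¹ + (G z)ᴴ * Λ.map Complex.ofReal * G z

/-- The admissible Lagrange multipliers: real symmetric `Λ` with `Ψ⁻¹ + G* Λ G > 0` almost
everywhere on the unit circle. -/
def IsMultiplier {n m : ℕ} (G : Circle → Matrix (Fin n) (Fin m) ℂ)
    (Ψ : Circle → Matrix (Fin m) (Fin m) ℂ) (Λ : Matrix (Fin n) (Fin n) ℝ) : Prop :=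
  Λ.IsSymm ∧ AECircle fun z => (inverseApproximant G Ψ Λ z).PosDef

/-- The approximant `Φ°(Λ) = [Ψ⁻¹ + G* Λ G]⁻¹`. -/
def approximant {n m : ℕ} (G : Circle → Matrix (Fin n) (Fin m) ℂ)
    (Ψ : Circle → Matrix (Fin m) (Fin m) ℂ) (Λ : Matrix (Fin n) (Fin n) ℝ) (z : Circle) :
    Matrix (Fin m) (Fin m) ℂ :=
  (inverseApproximant G Ψ Λ z)⁻¹

/-- The function `Φ` on the unit circle is (almost everywhere) rational, with McMillan degree at
most `d`. -/
def IsRationalOfDegreeLE {m : ℕ} (Φ : Circle → Matrix (Fin m) (Fin m) ℂ) (d : ℕ) : Prop :=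
  ∃ P : Matrix (Fin m) (Fin m) (RatFunc ℂ),
    (AECircle fun z => Φ z = onCircle P z) ∧ mcmillanDegree P ≤ d

end

/-! The degree bounds are local. At a place `x` of `ℂ ∪ {∞}` the multiplicity of a pole is the least
`k` bounding the pole orders of all minors (`MinorPoleLE`). Under sums and products these bounds
add, by Laplace and Cauchy–Binet expansion. By Jacobi's theorem a minor of `M⁻¹` is, up to sign, a
complementary minor of `M` over `det M`, so the multiplicity for `M⁻¹` is at most that for `M` minus
the pole order of `det M`. Those orders sum to zero over all places, whence `deg M⁻¹ ≤ deg M`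
(`mcmillanDegree_inv_le`). Now `z I - A` and `z⁻¹ I - Aᵀ` have poles only at `∞` and at `0`
respectively, of multiplicity at most `n`, so `G` and `G*` have degree at most `n`, and `[Ψ⁻¹ + G* Λ
G]⁻¹` has degree at most `deg Ψ + 2n`. Conversely, reachability writes `(z I - A)⁻¹` as `G` times a
polynomial matrix plus a polynomial matrix, so all roots of the characteristic polynomial count as
poles of `G`, and `deg G = n`.

The form of a minimizer `Φ` comes from the first variation, without duality. In the space of bounded
Hermitian functions with the form `∫ tr (F K)`, project `H = Ψ⁻¹ - Φ⁻¹`, the gradient of the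
distance up to a factor, onto the finite-dimensional space of functions `G* (M + Mᵀ) G`. The
remainder `D` is orthogonal to that space, hence has zero moments, and `Φ - t D` is feasible for
small `t > 0`. Minimality gives `⟨H, D⟩ ≤ 0`, while `⟨H, D⟩ = ⟨D, D⟩`; so `D = 0` almost everywhere
and `Φ⁻¹ = Ψ⁻¹ + G* Λ G` with `Λ = -(M + Mᵀ)` (`IsOptimalApproximant.exists_multiplier`). -/

noncomputable section

/-! ## Places of the rational function field and pole orders -/

/-- The order of the pole of `f` at a place of `ℂ ∪ {∞}` (`none` is the point at infinity);
negative at a zero of `f`. -/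
def placeOrd : Option ℂ → RatFunc ℂ → ℤ
  | none, f => f.intDegree
  | some a, f => (f.denom.rootMultiplicity a : ℤ) - f.num.rootMultiplicity a

/-- Cross-multiplication with the reduced fraction shows that the order can be read off any
fraction, reduced or not. -/
theorem placeOrd_some_div (a : ℂ) {p q : Polynomial ℂ} (hp : p ≠ 0) (hq : q ≠ 0) :
    placeOrd (some a) (algebraMap _ (RatFunc ℂ) p / algebraMap _ _ q) =
      (q.rootMultiplicity a : ℤ) - p.rootMultiplicity a := by
  set f : RatFunc ℂ := algebraMap _ (RatFunc ℂ) p / algebraMap _ _ q with hf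
  have hp' : algebraMap (Polynomial ℂ) (RatFunc ℂ) p ≠ 0 := by simpa using hp
  have hq' : algebraMap (Polynomial ℂ) (RatFunc ℂ) q ≠ 0 := by simpa using hq
  have hf0 : f ≠ 0 := div_ne_zero hp' hq'
  have h1 : f.num * q = p * f.denom := (RatFunc.num_mul_eq_mul_denom_iff hq).2 hf
  have h2 := congrArg (Polynomial.rootMultiplicity a) h1
  rw [Polynomial.rootMultiplicity_mul (mul_ne_zero (RatFunc.num_ne_zero hf0) hq),
    Polynomial.rootMultiplicity_mul (mul_ne_zero hp f.denom_ne_zero)] at h2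
  simp only [placeOrd]
  omega

/-- A default value: the true order is `-∞`, which is why `PoleLE` admits `0` separately. -/
theorem placeOrd_zero (p : Option ℂ) : placeOrd p 0 = 0 := by
  cases p <;> simp [placeOrd]

theorem placeOrd_C (p : Option ℂ) (c : ℂ) : placeOrd p (RatFunc.C c) = 0 := by
  cases p with
  | none => simp [placeOrd]
  | some a => simp [placeOrd]

theorem placeOrd_one (p : Option ℂ) : placeOrd p 1 = 0 := by
  simpa using placeOrd_C p 1

theorem placeOrd_mul (p : Option ℂ) {f g : RatFunc ℂ} (hf : f ≠ 0) (hg : g ≠ 0) :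
    placeOrd p (f * g) = placeOrd p f + placeOrd p g := by
  cases p with
  | none => exact RatFunc.intDegree_mul hf hg
  | some a =>
    have h : f * g = algebraMap _ _ (f.num * g.num) / algebraMap _ _ (f.denom * g.denom) := by
      conv_lhs => rw [← f.num_div_denom, ← g.num_div_denom]
      rw [div_mul_div_comm, map_mul, map_mul]
    have hn := mul_ne_zero (RatFunc.num_ne_zero hf) (RatFunc.num_ne_zero hg)
    have hd := mul_ne_zero f.denom_ne_zero g.denom_ne_zero
    rw [h, placeOrd_some_div a hn hd, Polynomial.rootMultiplicity_mul hn,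
      Polynomial.rootMultiplicity_mul hd]
    simp only [placeOrd]
    omega

theorem placeOrd_inv (p : Option ℂ) (f : RatFunc ℂ) : placeOrd p f⁻¹ = -placeOrd p f := by
  by_cases hf : f = 0
  · simp [hf, placeOrd_zero]
  · have h := placeOrd_mul p hf (inv_ne_zero hf)
    rw [mul_inv_cancel₀ hf, placeOrd_one] at h
    omega

theorem placeOrd_add_le (p : Option ℂ) {f g : RatFunc ℂ} (hf : f ≠ 0) (hg : g ≠ 0)
    (hfg : f + g ≠ 0) : placeOrd p (f + g) ≤ max (placeOrd p f) (placeOrd p g) := by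
  cases p with
  | none => exact RatFunc.intDegree_add_le hg hfg
  | some a =>
    have hd := mul_ne_zero f.denom_ne_zero g.denom_ne_zero
    have hd' : algebraMap (Polynomial ℂ) (RatFunc ℂ) f.denom ≠ 0 := by
      simpa using f.denom_ne_zero
    have hd'' : algebraMap (Polynomial ℂ) (RatFunc ℂ) g.denom ≠ 0 := by
      simpa using g.denom_ne_zero
    have h : f + g = algebraMap _ _ (f.num * g.denom + f.denom * g.num) /
        algebraMap _ _ (f.denom * g.denom) := by
      conv_lhs => rw [← f.num_div_denom, ← g.num_div_denom]
      rw [div_add_div _ _ hd' hd'', map_mul, map_add, map_mul, map_mul]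
    have hn : f.num * g.denom + f.denom * g.num ≠ 0 := by
      intro h0
      rw [h0] at h
      exact hfg (by simpa using h)
    have hm := Polynomial.rootMultiplicity_add (a := a) hn
    rw [Polynomial.rootMultiplicity_mul (mul_ne_zero (RatFunc.num_ne_zero hf) g.denom_ne_zero),
      Polynomial.rootMultiplicity_mul (mul_ne_zero f.denom_ne_zero (RatFunc.num_ne_zero hg))] at hm
    rw [h, placeOrd_some_div a hn hd, Polynomial.rootMultiplicity_mul hd]
    simp only [placeOrd]
    omega

/-- `f` has at `p` at most a pole of order `k` (a zero of order at least `-k` if `k < 0`). -/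
def PoleLE (p : Option ℂ) (k : ℤ) (f : RatFunc ℂ) : Prop := f = 0 ∨ placeOrd p f ≤ k

namespace PoleLE

variable {p : Option ℂ} {k l : ℤ} {f g : RatFunc ℂ}

theorem zero : PoleLE p k 0 := Or.inl rfl

theorem mono (h : PoleLE p k f) (hkl : k ≤ l) : PoleLE p l f := h.imp id fun h => h.trans hkl

theorem const (c : ℂ) : PoleLE p 0 (RatFunc.C c) := Or.inr (placeOrd_C p c).le

theorem mul (hf : PoleLE p k f) (hg : PoleLE p l g) : PoleLE p (k + l) (f * g) := by
  by_cases hf0 : f = 0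
  · simp [hf0, PoleLE]
  by_cases hg0 : g = 0
  · simp [hg0, PoleLE]
  refine Or.inr ?_
  rw [placeOrd_mul p hf0 hg0]
  exact add_le_add (hf.resolve_left hf0) (hg.resolve_left hg0)

theorem const_mul (c : ℂ) (hf : PoleLE p k f) : PoleLE p k (RatFunc.C c * f) := by
  simpa using (const c).mul hf

theorem of_const_mul {c : ℂ} (hc : c ≠ 0) (hf : PoleLE p k (RatFunc.C c * f)) :
    PoleLE p k f := by
  have h := hf.const_mul c⁻¹
  rwa [← mul_assoc, ← map_mul, inv_mul_cancel₀ hc, map_one, one_mul] at h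

theorem add (hf : PoleLE p k f) (hg : PoleLE p k g) : PoleLE p k (f + g) := by
  by_cases hf0 : f = 0
  · simpa [hf0] using hg
  by_cases hg0 : g = 0
  · simpa [hg0] using hf
  by_cases hfg : f + g = 0
  · exact Or.inl hfg
  exact Or.inr ((placeOrd_add_le p hf0 hg0 hfg).trans
    (max_le (hf.resolve_left hf0) (hg.resolve_left hg0)))

theorem sum {ι : Type*} (s : Finset ι) {F : ι → RatFunc ℂ} (h : ∀ i ∈ s, PoleLE p k (F i)) :
    PoleLE p k (∑ i ∈ s, F i) := by
  classical
  induction s using Finset.induction_on with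
  | empty => simpa using zero
  | insert a s ha ih =>
    rw [Finset.sum_insert ha]
    exact (h a (Finset.mem_insert_self _ _)).add
      (ih fun i hi => h i (Finset.mem_insert_of_mem hi))

end PoleLE

theorem poleLE_natCast_iff (p : Option ℂ) (k : ℕ) (f : RatFunc ℂ) :
    PoleLE p k f ↔ (placeOrd p f).toNat ≤ k := by
  rw [Int.toNat_le]
  refine ⟨fun h => h.elim (fun h => ?_) id, Or.inr⟩
  rw [h, placeOrd_zero]
  exact Int.natCast_nonneg k

/-- In lowest terms numerator and denominator have no common root, so truncation at zero leaves the
multiplicity in the denominator. -/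
theorem toNat_placeOrd_some (a : ℂ) (f : RatFunc ℂ) :
    (placeOrd (some a) f).toNat = f.denom.rootMultiplicity a := by
  simp only [placeOrd]
  by_cases hd : f.denom.IsRoot a
  · have hn : ¬ f.num.IsRoot a := by
      intro hn
      obtain ⟨u, v, huv⟩ := f.isCoprime_num_denom
      have h := congrArg (Polynomial.eval a) huv
      rw [Polynomial.IsRoot.def] at hn hd
      simp [hn, hd] at h
    rw [Polynomial.rootMultiplicity_eq_zero hn]
    simp
  · rw [Polynomial.rootMultiplicity_eq_zero hd]
    omega

/-- The degree of a principal divisor is zero. -/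
theorem sum_placeOrd {f : RatFunc ℂ} (hf : f ≠ 0) (s : Finset ℂ)
    (hs : ∀ a, placeOrd (some a) f ≠ 0 → a ∈ s) :
    ∑ a ∈ s, placeOrd (some a) f + placeOrd none f = 0 := by
  classical
  have key : ∀ (q : Polynomial ℂ), q ≠ 0 → ∀ t : Finset ℂ, q.roots.toFinset ⊆ t →
      ∑ a ∈ t, (q.rootMultiplicity a : ℤ) = q.natDegree := by
    intro q hq t ht
    rw [← Polynomial.splits_iff_card_roots.1 (IsAlgClosed.splits q),
      ← Multiset.toFinset_sum_count_eq, Nat.cast_sum]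
    symm
    refine Finset.sum_subset_zero_on_sdiff ht (fun a ha => ?_) fun a _ => by
      rw [Polynomial.count_roots]
    have h1 : a ∉ q.roots := fun h => (Finset.mem_sdiff.1 ha).2 (by simpa using h)
    rw [← Polynomial.count_roots, Multiset.count_eq_zero.2 h1, Nat.cast_zero]
  set t := s ∪ (f.num.roots.toFinset ∪ f.denom.roots.toFinset)
  have h1 : ∑ a ∈ s, placeOrd (some a) f = ∑ a ∈ t, placeOrd (some a) f :=
    Finset.sum_subset Finset.subset_union_left fun a _ ha => not_not.1 fun h => ha (hs a h)
  rw [h1]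
  simp only [placeOrd, Finset.sum_sub_distrib]
  rw [key _ f.denom_ne_zero t
      (Finset.subset_union_right.trans Finset.subset_union_right),
    key _ (RatFunc.num_ne_zero hf) t
      (Finset.subset_union_left.trans Finset.subset_union_right), RatFunc.intDegree]
  ring

/-! ## Expansions of determinants into minors -/

/-- The rows of `M * N` are combinations of the rows of `N`, and the determinant is multilinear in
them. Noninjective `t` contribute zero and may stay. -/
theorem Matrix.det_mul_eq_sum_prod {ι κ R : Type*} [Fintype ι] [DecidableEq ι] [Fintype κ]
    [CommRing R] (M : Matrix ι κ R) (N : Matrix κ ι R) :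
    (M * N).det = ∑ t : ι → κ, (∏ i, M i (t i)) * (N.submatrix t id).det := by
  have h : M * N = fun i => ∑ j, M i j • N j := by
    ext i j
    simp [Matrix.mul_apply, Finset.sum_apply]
  have h2 := (Matrix.detRowAlternating (n := ι) (R := R)).toMultilinearMap.map_sum
    (fun i j => M i j • N j)
  rw [h]
  refine h2.trans (Finset.sum_congr rfl fun t _ => ?_)
  rw [MultilinearMap.map_smul_univ]
  rfl

/-- The Cauchy–Binet formula combined with the Laplace expansion along two complementary sets of
rows, with sums over all maps instead of subsets. -/
theorem Matrix.factorial_mul_det_fromRows_mul {α β κ R : Type*} [Fintype α] [DecidableEq α]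
    [Fintype β] [DecidableEq β] [Fintype κ] [CommRing R]
    (M : Matrix α κ R) (N : Matrix β κ R) (L : Matrix κ (α ⊕ β) R) :
    ((Fintype.card α).factorial * (Fintype.card β).factorial : ℕ) *
        (Matrix.fromRows M N * L).det =
      ∑ t : α → κ, ∑ u : β → κ, (M.submatrix id t).det * (N.submatrix id u).det *
        (L.submatrix (Sum.elim t u) id).det := by
  -- Permuting the rows inside each block multiplies the determinant by known signs, so every pair
  -- `σ, τ` gives an expansion. Adding them all turns the row products into minors, at the price of
  -- the two factorials.
  have key : ∀ (σ : Equiv.Perm α) (τ : Equiv.Perm β), (Matrix.fromRows M N * L).det =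
      ∑ t : α → κ, ∑ u : β → κ, (Equiv.Perm.sign σ • ∏ i, M (σ i) (t i)) *
        (Equiv.Perm.sign τ • ∏ i, N (τ i) (u i)) * (L.submatrix (Sum.elim t u) id).det := by
    intro σ τ
    have h1 : (Matrix.fromRows (M.submatrix σ id) (N.submatrix τ id) * L) =
        (Matrix.fromRows M N * L).submatrix (Equiv.sumCongr σ τ) id := by
      ext i j
      cases i <;> rfl
    have h2 := congrArg Matrix.det h1
    rw [Matrix.det_permute, Equiv.Perm.sign_sumCongr, Matrix.det_mul_eq_sum_prod] at h2
    have h3 : (Matrix.fromRows M N * L).det =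
        ((Equiv.Perm.sign σ * Equiv.Perm.sign τ : ℤˣ) : R) *
          (((Equiv.Perm.sign σ * Equiv.Perm.sign τ : ℤˣ) : R) *
            (Matrix.fromRows M N * L).det) := by
      rw [← mul_assoc, ← Int.cast_mul, ← Units.val_mul, Int.units_mul_self]
      simp
    rw [h3, ← h2, ← (Equiv.sumArrowEquivProdArrow α β κ).symm.sum_comp, Fintype.sum_prod_type,
      Finset.mul_sum]
    refine Finset.sum_congr rfl fun t _ => ?_
    rw [Finset.mul_sum]
    refine Finset.sum_congr rfl fun u _ => ?_
    have h4 : ((Equiv.sumArrowEquivProdArrow α β κ).symm (t, u) : α ⊕ β → κ) =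
      Sum.elim t u := by
      ext i
      cases i <;> rfl
    rw [h4, Fintype.prod_sum_type]
    simp only [Matrix.fromRows_apply_inl, Matrix.fromRows_apply_inr, Matrix.submatrix_apply,
      Sum.elim_inl, Sum.elim_inr, id, Units.smul_def, zsmul_eq_mul, Units.val_mul, Int.cast_mul]
    ring
  have hsum : ∑ σ : Equiv.Perm α, ∑ τ : Equiv.Perm β, (Matrix.fromRows M N * L).det =
      ((Fintype.card α).factorial * (Fintype.card β).factorial : ℕ) *
        (Matrix.fromRows M N * L).det := by
    simp [Fintype.card_perm, mul_assoc]
  rw [← hsum, Finset.sum_congr rfl fun σ _ => Finset.sum_congr rfl fun τ _ => key σ τ]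
  simp_rw [Matrix.det_apply (M.submatrix id _), Matrix.det_apply (N.submatrix id _),
    Finset.sum_mul_sum, Finset.sum_mul, Matrix.submatrix_apply, id]
  rw [Finset.sum_congr rfl fun σ _ => Finset.sum_comm, Finset.sum_comm]
  refine Finset.sum_congr rfl fun t _ => ?_
  rw [Finset.sum_congr rfl fun σ _ => Finset.sum_comm, Finset.sum_comm]

/-! ## Pole orders of all minors of a rational matrix -/

/-- All minors of `M` have at `p` at most a pole of order `k`. -/
def MinorPoleLE {P Q : Type*} (p : Option ℂ) (k : ℤ) (M : Matrix P Q (RatFunc ℂ)) : Prop :=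
  ∀ (r : ℕ) (s : Fin r → P) (t : Fin r → Q), PoleLE p k (M.submatrix s t).det

namespace MinorPoleLE

variable {P Q S : Type*} {p : Option ℂ} {k l : ℤ}

theorem minor {M : Matrix P Q (RatFunc ℂ)} (h : MinorPoleLE p k M) {ι : Type*} [Fintype ι]
    [DecidableEq ι] (s : ι → P) (t : ι → Q) : PoleLE p k (M.submatrix s t).det := by
  have h1 := h _ (s ∘ (Fintype.equivFin ι).symm) (t ∘ (Fintype.equivFin ι).symm)
  rwa [← Matrix.submatrix_submatrix, Matrix.det_submatrix_equiv_self] at h1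

theorem det [Fintype P] [DecidableEq P] {M : Matrix P P (RatFunc ℂ)} (h : MinorPoleLE p k M) :
    PoleLE p k M.det := h.minor id id

theorem submatrix {M : Matrix P Q (RatFunc ℂ)} (h : MinorPoleLE p k M) {P' Q' : Type*}
    (s : P' → P) (t : Q' → Q) : MinorPoleLE p k (M.submatrix s t) :=
  fun r s' t' => h r (s ∘ s') (t ∘ t')

theorem transpose {M : Matrix P Q (RatFunc ℂ)} (h : MinorPoleLE p k M) :
    MinorPoleLE p k Mᵀ := fun r s t => by
  rw [← Matrix.transpose_submatrix, Matrix.det_transpose]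
  exact h r t s

/-- The empty minor is `1`, of order zero. -/
theorem nonneg {M : Matrix P Q (RatFunc ℂ)} (h : MinorPoleLE p k M) : 0 ≤ k := by
  have h1 := h 0 Fin.elim0 Fin.elim0
  rw [Matrix.det_isEmpty] at h1
  simpa [placeOrd_one] using h1.resolve_left one_ne_zero

theorem const (M : Matrix P Q ℂ) : MinorPoleLE p 0 (M.map RatFunc.C) := fun r s t => by
  have h : ((M.map RatFunc.C).submatrix s t).det = RatFunc.C (M.submatrix s t).det := by
    rw [RingHom.map_det]
    rfl
  rw [h]
  exact PoleLE.const _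

theorem one [DecidableEq P] : MinorPoleLE p 0 (1 : Matrix P P (RatFunc ℂ)) := by
  have h := const (p := p) (1 : Matrix P P ℂ)
  rwa [Matrix.map_one _ (map_zero _) (map_one _)] at h

theorem _root_.PoleLE.of_factorial_mul {N : ℕ} (hN : N ≠ 0) {f : RatFunc ℂ}
    (h : PoleLE p k ((N : RatFunc ℂ) * f)) : PoleLE p k f := by
  refine PoleLE.of_const_mul (c := (N : ℂ)) (Nat.cast_ne_zero.2 hN) ?_
  rwa [map_natCast]

/-- One expansion serves both arithmetic rules: an empty second block gives products, `L = 1` gives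
the Laplace expansion needed for sums. -/
theorem det_fromRows_mul {α β κ : Type*} [Fintype α] [DecidableEq α]
    [Fintype β] [DecidableEq β] [Fintype κ] {j : ℤ}
    {M : Matrix α κ (RatFunc ℂ)} {N : Matrix β κ (RatFunc ℂ)} {L : Matrix κ (α ⊕ β) (RatFunc ℂ)}
    (hM : MinorPoleLE p k M) (hN : MinorPoleLE p l N) (hL : MinorPoleLE p j L) :
    PoleLE p (k + l + j) (Matrix.fromRows M N * L).det := by
  refine PoleLE.of_factorial_mul (N := (Fintype.card α).factorial * (Fintype.card β).factorial)
    (mul_ne_zero (Nat.factorial_ne_zero _) (Nat.factorial_ne_zero _)) ?_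
  rw [Matrix.factorial_mul_det_fromRows_mul]
  exact PoleLE.sum _ fun t _ => PoleLE.sum _ fun u _ =>
    ((hM.minor _ _).mul (hN.minor _ _)).mul (hL.minor _ _)

theorem det_fromRows {α β : Type*} [Fintype α] [DecidableEq α] [Fintype β] [DecidableEq β]
    {M : Matrix α (α ⊕ β) (RatFunc ℂ)} {N : Matrix β (α ⊕ β) (RatFunc ℂ)}
    (hM : MinorPoleLE p k M) (hN : MinorPoleLE p l N) :
    PoleLE p (k + l) (Matrix.fromRows M N).det := by
  simpa using det_fromRows_mul hM hN one

theorem mul [Fintype Q] {M : Matrix P Q (RatFunc ℂ)} {N : Matrix Q S (RatFunc ℂ)}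
    (hM : MinorPoleLE p k M) (hN : MinorPoleLE p l N) : MinorPoleLE p (k + l) (M * N) := by
  intro r s t
  have h := det_fromRows_mul (hM.submatrix s id)
    (const (p := p) (0 : Matrix Empty Q ℂ)) (hN.submatrix id (Sum.elim t Empty.elim))
  rw [← Matrix.det_submatrix_equiv_self (Equiv.sumEmpty (Fin r) Empty).symm] at h
  rw [add_zero] at h
  exact h

/-- By multilinearity a minor of `M + N` is a sum over the sets `T` of rows taken from `M`, the
others coming from `N`; each term is expanded along these two groups of rows. -/
theorem add {M N : Matrix P Q (RatFunc ℂ)} (hM : MinorPoleLE p k M) (hN : MinorPoleLE p l N) :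
    MinorPoleLE p (k + l) (M + N) := by
  classical
  intro r s t
  have h := (Matrix.detRowAlternating (n := Fin r) (R := RatFunc ℂ)).toMultilinearMap.map_add_univ
    (M.submatrix s t) (N.submatrix s t)
  have h2 : ((M + N).submatrix s t).det = ∑ T : Finset (Fin r),
      (Matrix.of fun i j => if i ∈ T then M (s i) (t j) else N (s i) (t j)).det := by
    refine h.trans (Finset.sum_congr rfl fun T _ => congrArg Matrix.det ?_)
    ext i j
    by_cases hi : i ∈ T <;> simp [Finset.piecewise, hi]
  rw [h2]
  refine PoleLE.sum _ fun T _ => ?_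
  let e : {i // i ∈ T} ⊕ {i // i ∉ T} ≃ Fin r := Equiv.sumCompl (· ∈ T)
  have h3 := det_fromRows (hM.submatrix (fun i : {i // i ∈ T} => s i) (t ∘ e))
    (hN.submatrix (fun i : {i // i ∉ T} => s i) (t ∘ e))
  rw [← Matrix.det_submatrix_equiv_self e]
  convert! h3 using 2
  ext i j
  rcases i with i | i
  · exact if_pos i.2
  · exact if_neg i.2

theorem of_injective {M : Matrix P Q (RatFunc ℂ)}
    (h : ∀ (r : ℕ) (s : Fin r → P) (t : Fin r → Q), Function.Injective s →
      Function.Injective t → PoleLE p k (M.submatrix s t).det) : MinorPoleLE p k M := by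
  intro r s t
  by_cases hs : Function.Injective s
  · by_cases ht : Function.Injective t
    · exact h r s t hs ht
    · rw [Function.Injective] at ht
      push Not at ht
      obtain ⟨a, b, hab, hne⟩ := ht
      exact Or.inl (Matrix.det_zero_of_column_eq hne fun i => by simp [hab])
  · rw [Function.Injective] at hs
    push Not at hs
    obtain ⟨a, b, hab, hne⟩ := hs
    exact Or.inl (Matrix.det_zero_of_row_eq hne (by ext j; simp [hab]))

/-- Pole orders of the minors of an inverse, by Jacobi's theorem on complementary minors. -/
theorem inv [Fintype P] [DecidableEq P] {M : Matrix P P (RatFunc ℂ)} (h : MinorPoleLE p k M)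
    (hdet : M.det ≠ 0) : MinorPoleLE p (k - placeOrd p M.det) M⁻¹ := by
  classical
  refine of_injective fun r s t hs _ => ?_
  let κ := {i : P // i ∉ Set.range s}
  let e : Fin r ⊕ κ ≃ P := (Equiv.sumCongr (Equiv.ofInjective s hs) (Equiv.refl _)).trans
    (Equiv.sumCompl (· ∈ Set.range s))
  have he1 : ∀ i, e (Sum.inl i) = s i := fun _ => rfl
  have he2 : ∀ i : κ, e (Sum.inr i) = i := fun _ => rfl
  let N := M⁻¹
  have hMN : M * N = 1 := Matrix.mul_nonsing_inv M (isUnit_iff_ne_zero.2 hdet)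
  -- `T` puts the chosen columns of `N` next to the unit columns for the rows outside `s`, so its
  -- determinant is the minor of `N`. In `M * T` these become unit columns next to columns of `M`,
  -- and Laplace expansion bounds the order by `0 + k`.
  let T : Matrix (Fin r ⊕ κ) (Fin r ⊕ κ) (RatFunc ℂ) :=
    Matrix.fromBlocks (N.submatrix s t) 0 (N.submatrix (fun i : κ => (i : P)) t) 1
  have hT : T = (Matrix.fromCols (N.submatrix id t)
      ((1 : Matrix P P (RatFunc ℂ)).submatrix id (fun i : κ => (i : P)))).submatrix e id := by
    ext i j
    rcases i with i | i <;> rcases j with j | j <;>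
      simp only [T, he1, he2, Matrix.one_apply, Matrix.submatrix_apply, Matrix.fromBlocks_apply₁₁,
        Matrix.fromBlocks_apply₁₂, Matrix.fromBlocks_apply₂₁, Matrix.fromBlocks_apply₂₂,
        Matrix.fromCols_apply_inl, Matrix.fromCols_apply_inr, id, Matrix.zero_apply]
    · exact (if_neg fun h => j.2 ⟨i, h⟩).symm
    · exact if_congr Subtype.ext_iff rfl rfl
  have hprod : M.submatrix e e * T = (Matrix.fromCols ((1 : Matrix P P (RatFunc ℂ)).submatrix id t)
      (M.submatrix id (fun i : κ => (i : P)))).submatrix e id := by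
    rw [hT, Matrix.submatrix_mul_equiv, Matrix.mul_fromCols]
    congr 2
    · rw [← hMN]
      rfl
    · conv_rhs => rw [← Matrix.mul_one M]
      rfl
  have hd := congrArg Matrix.det hprod
  rw [Matrix.det_mul, Matrix.det_submatrix_equiv_self, Matrix.det_fromBlocks_zero₁₂,
    Matrix.det_one, mul_one] at hd
  have hb : PoleLE p (0 + k) (M.det * (N.submatrix s t).det) := by
    rw [hd, ← Matrix.det_transpose]
    have h5 := det_fromRows ((one (p := p) (P := P)).submatrix t e)
      (h.transpose.submatrix (fun i : κ => (i : P)) e)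
    convert! h5 using 2
    ext i j
    rcases i with i | i
    · simp [Matrix.one_apply, eq_comm]
    · simp
  by_cases h0 : (N.submatrix s t).det = 0
  · exact Or.inl h0
  · have h6 := hb.resolve_left (mul_ne_zero hdet h0)
    rw [placeOrd_mul p hdet h0] at h6
    exact Or.inr (by change placeOrd p (N.submatrix s t).det ≤ _; omega)

/-- A scalar matrix of size `q` has minors of pole order at most `q` times that of the scalar. -/
theorem scalar [Fintype P] [DecidableEq P] {f : RatFunc ℂ} {k : ℕ} (hf : PoleLE p k f) :
    MinorPoleLE p (Fintype.card P * k : ℕ) (Matrix.scalar P f) := by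
  refine of_injective fun r s t hs _ => ?_
  have hr : r ≤ Fintype.card P := by simpa using Fintype.card_le_of_injective s hs
  have h1 : (Matrix.scalar P f).submatrix s t =
      f • (1 : Matrix P P (RatFunc ℂ)).submatrix s t := by
    ext i j
    simp [Matrix.diagonal_apply, Matrix.one_apply]
  rw [h1, Matrix.det_smul, Fintype.card_fin]
  have h2 : ∀ n : ℕ, PoleLE p (n * k : ℕ) (f ^ n) := by
    intro n
    induction n with
    | zero => simpa using PoleLE.const (p := p) 1
    | succ n ih =>
      rw [pow_succ]
      refine (ih.mul hf).mono (le_of_eq ?_)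
      push_cast
      ring
  have h3 := (h2 r).mul ((one (p := p)) r s t)
  refine h3.mono ?_
  rw [add_zero]
  exact_mod_cast Nat.mul_le_mul_right k hr

end MinorPoleLE

/-! ## Arithmetic of the McMillan degree -/

/-- Multiplicity of a point of `ℂ ∪ {∞}` as a pole of `M`. -/
def poleDegree {p q : ℕ} (x : Option ℂ) (M : Matrix (Fin p) (Fin q) (RatFunc ℂ)) : ℕ :=
  x.elim (poleMultiplicityInfty M) (poleMultiplicity M)

theorem poleDegree_eq_sup {p q : ℕ} (x : Option ℂ) (M : Matrix (Fin p) (Fin q) (RatFunc ℂ)) :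
    poleDegree x M = Finset.univ.sup fun s : MinorIndex p q => (placeOrd x (ratMinor M s)).toNat := by
  cases x with
  | none => rfl
  | some a => simp_rw [toNat_placeOrd_some]; rfl

theorem minorPoleLE_iff_poleDegree_le {p q : ℕ} {x : Option ℂ}
    {M : Matrix (Fin p) (Fin q) (RatFunc ℂ)} {k : ℕ} :
    MinorPoleLE x k M ↔ poleDegree x M ≤ k := by
  rw [poleDegree_eq_sup, Finset.sup_le_iff]
  constructor
  · intro h s _
    exact (poleLE_natCast_iff _ _ _).1 (h _ _ _)
  · intro h
    refine MinorPoleLE.of_injective fun r s t hs ht => ?_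
    have h1 : r ≤ min p q := le_min (by simpa using Fintype.card_le_of_injective s hs)
      (by simpa using Fintype.card_le_of_injective t ht)
    exact (poleLE_natCast_iff _ _ _).2 (h ⟨⟨r, by omega⟩, s, t⟩ (Finset.mem_univ _))

theorem minorPoleLE_poleDegree {p q : ℕ} (x : Option ℂ)
    (M : Matrix (Fin p) (Fin q) (RatFunc ℂ)) : MinorPoleLE x (poleDegree x M) M :=
  minorPoleLE_iff_poleDegree_le.2 le_rfl

theorem mcmillanDegree_eq_sum {p q : ℕ} (M : Matrix (Fin p) (Fin q) (RatFunc ℂ)) (T : Finset ℂ)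
    (hT : ∀ a, poleDegree (some a) M ≠ 0 → a ∈ T) :
    mcmillanDegree M = ∑ a ∈ T, poleDegree (some a) M + poleDegree none M := by
  have h : ∑ᶠ a : ℂ, poleMultiplicity M a = ∑ a ∈ T, poleMultiplicity M a :=
    finsum_eq_sum_of_support_subset _ fun a ha => hT a ha
  rw [mcmillanDegree, h]
  rfl

/-- The finite poles of `M`. -/
def finitePoles {p q : ℕ} (M : Matrix (Fin p) (Fin q) (RatFunc ℂ)) : Finset ℂ :=
  (poleMultiplicity_support_finite M).toFinset

theorem mem_finitePoles {p q : ℕ} {M : Matrix (Fin p) (Fin q) (RatFunc ℂ)} {a : ℂ} :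
    a ∈ finitePoles M ↔ poleDegree (some a) M ≠ 0 := by
  rw [finitePoles, Set.Finite.mem_toFinset]
  rfl

/-- The degree is a sum of local terms; merging the three pole sets lets the sums be compared
termwise. -/
theorem mcmillanDegree_le_add {p q p' q' p'' q'' : ℕ} {M : Matrix (Fin p) (Fin q) (RatFunc ℂ)}
    {N : Matrix (Fin p') (Fin q') (RatFunc ℂ)} {L : Matrix (Fin p'') (Fin q'') (RatFunc ℂ)}
    (h : ∀ x, poleDegree x L ≤ poleDegree x M + poleDegree x N) :
    mcmillanDegree L ≤ mcmillanDegree M + mcmillanDegree N := by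
  classical
  let T := finitePoles M ∪ finitePoles N ∪ finitePoles L
  rw [mcmillanDegree_eq_sum M T fun a ha => by simp [T, mem_finitePoles.2 ha],
    mcmillanDegree_eq_sum N T fun a ha => by simp [T, mem_finitePoles.2 ha],
    mcmillanDegree_eq_sum L T fun a ha => by simp [T, mem_finitePoles.2 ha]]
  have h1 := Finset.sum_le_sum fun a (_ : a ∈ T) => h (some a)
  rw [Finset.sum_add_distrib] at h1
  have h2 := h none
  omega

theorem mcmillanDegree_add_le {p q : ℕ} (M N : Matrix (Fin p) (Fin q) (RatFunc ℂ)) :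
    mcmillanDegree (M + N) ≤ mcmillanDegree M + mcmillanDegree N :=
  mcmillanDegree_le_add fun x => minorPoleLE_iff_poleDegree_le.1 (by
    push_cast
    exact (minorPoleLE_poleDegree x M).add (minorPoleLE_poleDegree x N))

theorem mcmillanDegree_mul_le {p q r : ℕ} (M : Matrix (Fin p) (Fin q) (RatFunc ℂ))
    (N : Matrix (Fin q) (Fin r) (RatFunc ℂ)) :
    mcmillanDegree (M * N) ≤ mcmillanDegree M + mcmillanDegree N :=
  mcmillanDegree_le_add fun x => minorPoleLE_iff_poleDegree_le.1 (by
    push_cast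
    exact (minorPoleLE_poleDegree x M).mul (minorPoleLE_poleDegree x N))

/-- The term `placeOrd x M.det` has to be kept: `M⁻¹` may have poles where `M` has none, and only
the sum of these terms over all places vanishes. -/
theorem poleDegree_inv_le {p : ℕ} (x : Option ℂ) {M : Matrix (Fin p) (Fin p) (RatFunc ℂ)}
    (hM : M.det ≠ 0) : (poleDegree x M⁻¹ : ℤ) ≤ poleDegree x M - placeOrd x M.det := by
  have h := (minorPoleLE_poleDegree x M).inv hM
  have h1 : ((poleDegree x M - placeOrd x M.det).toNat : ℤ) = poleDegree x M - placeOrd x M.det :=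
    Int.toNat_of_nonneg h.nonneg
  rw [← h1] at h ⊢
  exact_mod_cast minorPoleLE_iff_poleDegree_le.1 h

theorem mcmillanDegree_le_of_forall_ne {p q : ℕ} {M : Matrix (Fin p) (Fin q) (RatFunc ℂ)}
    (x : Option ℂ) {k : ℕ} (hx : MinorPoleLE x k M) (h : ∀ y, y ≠ x → MinorPoleLE y 0 M) :
    mcmillanDegree M ≤ k := by
  have h0 : ∀ y, y ≠ x → poleDegree y M = 0 := fun y hy =>
    Nat.le_zero.1 (minorPoleLE_iff_poleDegree_le.1 (by exact_mod_cast h y hy))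
  have hx' := minorPoleLE_iff_poleDegree_le.1 hx
  cases x with
  | none =>
    rw [mcmillanDegree_eq_sum M ∅ fun a ha => absurd (h0 (some a) (by simp)) ha]
    simpa using hx'
  | some b =>
    rw [mcmillanDegree_eq_sum M {b} fun a ha => by
      by_contra hab
      exact ha (h0 (some a) (by simpa using hab)), h0 none (by simp)]
    simpa using hx'

theorem mcmillanDegree_map_C {p q : ℕ} (M : Matrix (Fin p) (Fin q) ℂ) :
    mcmillanDegree (M.map RatFunc.C) = 0 :=
  Nat.le_zero.1 (mcmillanDegree_le_of_forall_ne none (by exact_mod_cast MinorPoleLE.const M)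
    fun _ _ => MinorPoleLE.const M)

/-- Summing the local bounds leaves the degree of the divisor of `M.det` as the only correction, and
that is zero. A singular `M` has `M⁻¹ = 0` by convention. -/
theorem mcmillanDegree_inv_le {p : ℕ} (M : Matrix (Fin p) (Fin p) (RatFunc ℂ)) :
    mcmillanDegree M⁻¹ ≤ mcmillanDegree M := by
  classical
  by_cases hM : M.det = 0
  · have h := mcmillanDegree_map_C (0 : Matrix (Fin p) (Fin p) ℂ)
    rw [Matrix.map_zero _ (map_zero _)] at h
    rw [Matrix.nonsing_inv_apply_not_isUnit _ (by simp [hM]), h]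
    exact Nat.zero_le _
  let T := finitePoles M ∪ finitePoles M⁻¹ ∪
    (M.det.num.roots.toFinset ∪ M.det.denom.roots.toFinset)
  have h0 := sum_placeOrd hM T fun a ha => by
    by_contra hT
    simp only [T, Finset.mem_union, not_or, Multiset.mem_toFinset,
      Polynomial.mem_roots (RatFunc.num_ne_zero hM), Polynomial.mem_roots M.det.denom_ne_zero] at hT
    apply ha
    rw [placeOrd, Polynomial.rootMultiplicity_eq_zero hT.2.1,
      Polynomial.rootMultiplicity_eq_zero hT.2.2]
    rfl
  rw [mcmillanDegree_eq_sum M T fun a ha => by simp [T, mem_finitePoles.2 ha],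
    mcmillanDegree_eq_sum M⁻¹ T fun a ha => by simp [T, mem_finitePoles.2 ha]]
  have h1 := Finset.sum_le_sum fun a (_ : a ∈ T) => poleDegree_inv_le (some a) hM
  rw [Finset.sum_sub_distrib] at h1
  have h2 := poleDegree_inv_le none hM
  zify
  omega

theorem MinorPoleLE.scalar_sub_const {n : ℕ} {x : Option ℂ} {k : ℕ} {f : RatFunc ℂ}
    (hf : PoleLE x k f) (A : Matrix (Fin n) (Fin n) ℂ) :
    MinorPoleLE x (n * k : ℕ) (Matrix.scalar (Fin n) f - A.map RatFunc.C) := by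
  have h := (MinorPoleLE.scalar (P := Fin n) hf).add (MinorPoleLE.const (-A))
  rw [Fintype.card_fin, add_zero] at h
  convert! h using 1
  ext i j
  simp [sub_eq_add_neg]

theorem placeOrd_X_of_ne {a : ℂ} (ha : a ≠ 0) : placeOrd (some a) RatFunc.X = 0 := by
  simp [placeOrd, Polynomial.rootMultiplicity_eq_zero, ha]

theorem placeOrd_X_zero : placeOrd (some 0) RatFunc.X = -1 := by
  have h : Polynomial.rootMultiplicity (0 : ℂ) Polynomial.X = 1 := by
    simpa using Polynomial.rootMultiplicity_X_sub_C_self (x := (0 : ℂ))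
  simp [placeOrd, h, Polynomial.rootMultiplicity_eq_zero]

theorem poleLE_X_some (a : ℂ) : PoleLE (some a) 0 RatFunc.X := by
  refine Or.inr ?_
  simp [placeOrd, Polynomial.rootMultiplicity_eq_zero]

theorem mcmillanDegree_X_sub_le {n : ℕ} (A : Matrix (Fin n) (Fin n) ℂ) :
    mcmillanDegree (Matrix.scalar (Fin n) RatFunc.X - A.map RatFunc.C) ≤ n := by
  refine mcmillanDegree_le_of_forall_ne none ?_ fun y hy => ?_
  · simpa using MinorPoleLE.scalar_sub_const (k := 1) (Or.inr (by simp [placeOrd])) A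
  · obtain ⟨a, rfl⟩ := Option.ne_none_iff_exists'.1 hy
    simpa using MinorPoleLE.scalar_sub_const (k := 0) (poleLE_X_some a) A

/-- The origin replaces infinity: it carries the only pole of `X⁻¹`, a simple one. -/
theorem mcmillanDegree_X_inv_sub_le {n : ℕ} (A : Matrix (Fin n) (Fin n) ℂ) :
    mcmillanDegree (Matrix.scalar (Fin n) (RatFunc.X)⁻¹ - A.map RatFunc.C) ≤ n := by
  refine mcmillanDegree_le_of_forall_ne (some 0) ?_ fun y hy => ?_
  · simpa using MinorPoleLE.scalar_sub_const (k := 1)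
      (Or.inr (by rw [placeOrd_inv, placeOrd_X_zero]; simp)) A
  · have h : placeOrd y (RatFunc.X)⁻¹ ≤ 0 := by
      rw [placeOrd_inv]
      cases y with
      | none => simp [placeOrd]
      | some a => rw [placeOrd_X_of_ne fun h => hy (by rw [h])]; simp
    simpa using MinorPoleLE.scalar_sub_const (k := 0) (Or.inr h) A

/-! ## Degree of the transfer function -/

namespace MinorPoleLE

variable {P Q S : Type*} {p : Option ℂ}

theorem zero_sum {ι : Type*} (s : Finset ι) {F : ι → Matrix P Q (RatFunc ℂ)}
    (h : ∀ i ∈ s, MinorPoleLE p 0 (F i)) : MinorPoleLE p 0 (∑ i ∈ s, F i) := by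
  classical
  induction s using Finset.induction_on with
  | empty =>
    have h := const (p := p) (0 : Matrix P Q ℂ)
    rw [Matrix.map_zero _ (map_zero _)] at h
    simpa using h
  | insert a s ha ih =>
    rw [Finset.sum_insert ha]
    exact (h a (Finset.mem_insert_self _ _)).add
      (ih fun i hi => h i (Finset.mem_insert_of_mem hi))

theorem zero_pow [Fintype P] [DecidableEq P] {M : Matrix P P (RatFunc ℂ)} (h : MinorPoleLE p 0 M)
    (n : ℕ) : MinorPoleLE p 0 (M ^ n) := by
  induction n with
  | zero => rw [pow_zero]; exact one
  | succ n ih => rw [pow_succ]; exact ih.mul h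

theorem neg {k : ℤ} {M : Matrix P Q (RatFunc ℂ)} (h : MinorPoleLE p k M) :
    MinorPoleLE p k (-M) := fun r s t => by
  have h1 : (-M).submatrix s t = -(M.submatrix s t) := rfl
  rw [h1, Matrix.det_neg]
  simpa using (h r s t).const_mul ((-1) ^ Fintype.card (Fin r))

end MinorPoleLE

theorem det_scalar_X_sub {n : ℕ} (A : Matrix (Fin n) (Fin n) ℂ) :
    (Matrix.scalar (Fin n) RatFunc.X - A.map RatFunc.C).det =
      algebraMap _ (RatFunc ℂ) A.charpoly := by
  rw [Matrix.charpoly, RingHom.map_det]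
  congr 1
  ext i j
  by_cases h : i = j
  · subst h
    simp [RatFunc.algebraMap_X, RatFunc.algebraMap_C]
  · simp [h, RatFunc.algebraMap_C]

theorem transferFunction_eq {n m : ℕ} (A : Matrix (Fin n) (Fin n) ℝ)
    (B : Matrix (Fin n) (Fin m) ℝ) : transferFunction A B =
      (Matrix.scalar (Fin n) RatFunc.X - (A.map Complex.ofReal).map RatFunc.C)⁻¹ *
        (B.map Complex.ofReal).map RatFunc.C := rfl

theorem mcmillanDegree_transferFunction_le {n m : ℕ} (A : Matrix (Fin n) (Fin n) ℝ)
    (B : Matrix (Fin n) (Fin m) ℝ) : mcmillanDegree (transferFunction A B) ≤ n := by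
  rw [transferFunction_eq]
  refine (mcmillanDegree_mul_le _ _).trans ?_
  rw [mcmillanDegree_map_C, add_zero]
  exact (mcmillanDegree_inv_le _).trans (mcmillanDegree_X_sub_le _)

/-- Reachability gives a right inverse of the reachability matrix. -/
theorem exists_sum_pow_mul_mul_eq_one {n m : ℕ} {A : Matrix (Fin n) (Fin n) ℝ}
    {B : Matrix (Fin n) (Fin m) ℝ}
    (h : Submodule.span ℝ
      (Set.range fun s : Fin n × Fin m => fun i => (A ^ (s.1 : ℕ) * B) i s.2) = ⊤) :
    ∃ K : Fin n → Matrix (Fin m) (Fin n) ℝ, ∑ k : Fin n, A ^ (k : ℕ) * B * K k = 1 := by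
  have h1 : ∀ j : Fin n, ∃ c : Fin n × Fin m → ℝ,
      ∑ s, c s • (fun i => (A ^ (s.1 : ℕ) * B) i s.2) = Pi.single j (1 : ℝ) := fun j =>
    (Submodule.mem_span_range_iff_exists_fun ℝ).1 (by rw [h]; trivial)
  choose c hc using h1
  refine ⟨fun k => Matrix.of fun l j => c j (k, l), ?_⟩
  ext i j
  have h2 := congrFun (hc j) i
  rw [Finset.sum_apply, Fintype.sum_prod_type] at h2
  rw [Matrix.sum_apply, Matrix.one_apply, ← Pi.single_apply, ← h2]
  refine Finset.sum_congr rfl fun k _ => ?_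
  rw [Matrix.mul_apply]
  refine Finset.sum_congr rfl fun l _ => ?_
  simp [mul_comm]

/-- Since `x - A` divides `x ^ k - A ^ k`, the product `(x - A)⁻¹ A ^ k` equals `x ^ k (x - A)⁻¹` up
to a polynomial in `x`. Apply this to each term of `∑ A ^ k B K_k = 1`. -/
theorem inv_scalar_X_sub_eq {n m : ℕ} {R : Type*} [CommRing R] (x : R)
    (A : Matrix (Fin n) (Fin n) R) (B : Matrix (Fin n) (Fin m) R)
    (K : Fin n → Matrix (Fin m) (Fin n) R) (hK : ∑ k : Fin n, A ^ (k : ℕ) * B * K k = 1)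
    (hdet : IsUnit (Matrix.scalar (Fin n) x - A).det) :
    (Matrix.scalar (Fin n) x - A)⁻¹ =
      (Matrix.scalar (Fin n) x - A)⁻¹ * B * (∑ k : Fin n, Matrix.scalar (Fin m) x ^ (k : ℕ) * K k) +
        -∑ k : Fin n, (∑ i ∈ Finset.range k, Matrix.scalar (Fin n) x ^ i * A ^ (k - 1 - i : ℕ)) *
          (B * K k) := by
  set Z := Matrix.scalar (Fin n) x - A with hZ
  have h1 : ∀ k : Fin n, Z⁻¹ * (A ^ (k : ℕ) * B * K k) =
      Z⁻¹ * B * (Matrix.scalar (Fin m) x ^ (k : ℕ) * K k) -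
      (∑ i ∈ Finset.range k, Matrix.scalar (Fin n) x ^ i * A ^ (k - 1 - i : ℕ)) * (B * K k) := by
    intro k
    have hc : Commute (Matrix.scalar (Fin n) x) A := Matrix.scalar_commute x (fun _ => mul_comm _ _) A
    have h2 := hc.mul_geom_sum₂ k
    have h3 : A ^ (k : ℕ) = Matrix.scalar (Fin n) x ^ (k : ℕ) -
        Z * ∑ i ∈ Finset.range k, Matrix.scalar (Fin n) x ^ i * A ^ (k - 1 - i : ℕ) := by
      rw [h2, sub_sub_cancel]
    have h4 : Matrix.scalar (Fin n) x ^ (k : ℕ) * B = B * Matrix.scalar (Fin m) x ^ (k : ℕ) := by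
      rw [← map_pow, ← map_pow]
      ext i j
      simp [mul_comm]
    rw [h3, Matrix.sub_mul, Matrix.sub_mul, h4, Matrix.mul_sub]
    congr 1
    · simp only [Matrix.mul_assoc]
    · rw [Matrix.mul_assoc Z, Matrix.mul_assoc Z, Matrix.nonsing_inv_mul_cancel_left _ _ hdet,
        Matrix.mul_assoc]
  rw [← sub_eq_add_neg, Matrix.mul_sum, ← Finset.sum_sub_distrib]
  simp_rw [← h1]
  rw [← Matrix.mul_sum, hK, Matrix.mul_one]

/-- Polynomial matrices have no finite poles, so at `a` the resolvent has at most the pole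
multiplicity of `G`; and its determinant is the reciprocal of the characteristic polynomial. -/
theorem rootMultiplicity_charpoly_le_poleDegree {n m : ℕ} {A : Matrix (Fin n) (Fin n) ℝ}
    {B : Matrix (Fin n) (Fin m) ℝ}
    (h : Submodule.span ℝ
      (Set.range fun s : Fin n × Fin m => fun i => (A ^ (s.1 : ℕ) * B) i s.2) = ⊤) (a : ℂ) :
    (A.map Complex.ofReal).charpoly.rootMultiplicity a ≤
      poleDegree (some a) (transferFunction A B) := by
  obtain ⟨K, hK⟩ := exists_sum_pow_mul_mul_eq_one h
  set A' := A.map Complex.ofReal with hA'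
  let ρ : ℝ →+* RatFunc ℂ := RatFunc.C.comp Complex.ofRealHom
  have hchar : A'.charpoly ≠ 0 := A'.charpoly_monic.ne_zero
  have hdet : (Matrix.scalar (Fin n) RatFunc.X - A'.map RatFunc.C).det ≠ 0 := by
    rw [det_scalar_X_sub]
    simpa using hchar
  have hK' : ∑ k : Fin n, (A'.map RatFunc.C) ^ (k : ℕ) * ((B.map Complex.ofReal).map RatFunc.C) *
      (((K k).map Complex.ofReal).map RatFunc.C) = 1 := by
    have h1 := congrArg ρ.mapMatrix hK
    rw [map_one, map_sum] at h1
    rw [← h1]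
    refine Finset.sum_congr rfl fun k _ => ?_
    rw [RingHom.mapMatrix_apply, Matrix.map_mul, Matrix.map_mul, Matrix.map_pow]
    rfl
  have hX : ∀ q : ℕ, MinorPoleLE (some a) 0 (Matrix.scalar (Fin q) (RatFunc.X : RatFunc ℂ)) :=
    fun q => by simpa using MinorPoleLE.scalar (k := 0) (P := Fin q) (poleLE_X_some a)
  have hinv := inv_scalar_X_sub_eq RatFunc.X _ _ _ hK' (isUnit_iff_ne_zero.2 hdet)
  have hle : MinorPoleLE (some a) (poleDegree (some a) (transferFunction A B) + 0 + 0)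
      (Matrix.scalar (Fin n) RatFunc.X - A'.map RatFunc.C)⁻¹ := by
    rw [hinv]
    refine ((minorPoleLE_poleDegree (some a) (transferFunction A B)).mul ?_).add
      (MinorPoleLE.neg ?_)
    · exact MinorPoleLE.zero_sum _ fun k _ => ((hX m).zero_pow k).mul (MinorPoleLE.const _)
    · exact MinorPoleLE.zero_sum _ fun k _ => (MinorPoleLE.zero_sum _ fun i _ =>
        ((hX n).zero_pow i).mul ((MinorPoleLE.const _).zero_pow _)).mul
          ((MinorPoleLE.const _).mul (MinorPoleLE.const _))
  have hd := hle.det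
  rw [Matrix.det_nonsing_inv, Ring.inverse_eq_inv'] at hd
  have h2 := hd.resolve_left (inv_ne_zero hdet)
  rw [placeOrd_inv, det_scalar_X_sub] at h2
  simp only [placeOrd, RatFunc.denom_algebraMap, RatFunc.num_algebraMap,
    Polynomial.rootMultiplicity_eq_zero (show ¬ (1 : Polynomial ℂ).IsRoot a by simp)] at h2
  push_cast at h2
  omega

theorem mcmillanDegree_transferFunction {n m : ℕ} {A : Matrix (Fin n) (Fin n) ℝ}
    {B : Matrix (Fin n) (Fin m) ℝ}
    (h : Submodule.span ℝ
      (Set.range fun s : Fin n × Fin m => fun i => (A ^ (s.1 : ℕ) * B) i s.2) = ⊤) :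
    mcmillanDegree (transferFunction A B) = n := by
  classical
  refine le_antisymm (mcmillanDegree_transferFunction_le A B) ?_
  set q := (A.map Complex.ofReal).charpoly
  have h1 : ∑ a ∈ q.roots.toFinset, q.rootMultiplicity a = n := by
    have h2 : q.natDegree = n := by simp [q, Matrix.charpoly_natDegree_eq_dim]
    conv_rhs => rw [← h2, ← Polynomial.splits_iff_card_roots.1 (IsAlgClosed.splits q),
      ← Multiset.toFinset_sum_count_eq]
    exact Finset.sum_congr rfl fun a _ => by rw [Polynomial.count_roots]
  have h3 : ∀ s : Finset ℂ, ∑ a ∈ s, q.rootMultiplicity a ≤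
      ∑ a ∈ s, poleDegree (some a) (transferFunction A B) := fun s =>
    Finset.sum_le_sum fun a _ => rootMultiplicity_charpoly_le_poleDegree h a
  rw [mcmillanDegree_eq_sum _ (q.roots.toFinset ∪ finitePoles (transferFunction A B))
    fun a ha => by simp [mem_finitePoles.2 ha]]
  have h4 := h3 (q.roots.toFinset ∪ finitePoles (transferFunction A B))
  have h5 := Finset.sum_le_sum_of_subset (f := fun a => q.rootMultiplicity a)
    (Finset.subset_union_left (s₁ := q.roots.toFinset)
      (s₂ := finitePoles (transferFunction A B)))
  omega

/-! ## Evaluation of rational matrices -/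

/-- The rational functions without a pole at `z`. -/
def regularAt (z : ℂ) : Subring (RatFunc ℂ) where
  carrier := {f | f.denom.eval z ≠ 0}
  mul_mem' {f g} hf hg h := by
    have h1 := Polynomial.eval_dvd (x := z) (RatFunc.denom_mul_dvd f g)
    rw [h, zero_dvd_iff, Polynomial.eval_mul] at h1
    exact mul_ne_zero hf hg h1
  add_mem' {f g} hf hg h := by
    have h1 := Polynomial.eval_dvd (x := z) (RatFunc.denom_add_dvd f g)
    rw [h, zero_dvd_iff, Polynomial.eval_mul] at h1
    exact mul_ne_zero hf hg h1
  one_mem' := by simp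
  zero_mem' := by simp
  neg_mem' {f} hf h := by
    have h1 : (-f).denom ∣ f.denom := by
      rw [RatFunc.denom_dvd f.denom_ne_zero]
      exact ⟨-f.num, by rw [map_neg, neg_div, RatFunc.num_div_denom]⟩
    have h2 := Polynomial.eval_dvd (x := z) h1
    rw [h, zero_dvd_iff] at h2
    exact hf h2

theorem mem_regularAt {z : ℂ} {f : RatFunc ℂ} : f ∈ regularAt z ↔ f.denom.eval z ≠ 0 := Iff.rfl

/-- Evaluation of the rational functions without a pole at `z`. -/
def evalAt (z : ℂ) : regularAt z →+* ℂ where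
  toFun f := RatFunc.eval (RingHom.id ℂ) z f
  map_one' := RatFunc.eval_one _ _
  map_zero' := RatFunc.eval_zero _ _
  -- Regularity is essential: at a pole the value defaults to `0`, and ring operations are not
  -- respected.
  map_mul' f g := RatFunc.eval_mul _ _ f.2 g.2
  map_add' f g := RatFunc.eval_add _ _ f.2 g.2

theorem C_mem_regularAt (z c : ℂ) : RatFunc.C c ∈ regularAt z := by
  simp [mem_regularAt]

theorem X_mem_regularAt (z : ℂ) : RatFunc.X ∈ regularAt z := by
  simp [mem_regularAt]

/-- The denominator of `f⁻¹` divides the numerator of `f`, and a root of the latter would give `f`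
the value zero. -/
theorem inv_mem_regularAt {z : ℂ} {f : RatFunc ℂ} (h : RatFunc.eval (RingHom.id ℂ) z f ≠ 0) :
    f⁻¹ ∈ regularAt z := by
  have hf : f ≠ 0 := by
    rintro rfl
    simp at h
  intro h1
  have h2 := Polynomial.eval_dvd (x := z) (RatFunc.denom_inv_dvd hf)
  rw [h1, zero_dvd_iff] at h2
  apply h
  rw [RatFunc.eval, ← Polynomial.eval, h2, zero_div]

/-- All entries of `M` are regular at `z`. -/
def IsRegularAt {P Q : Type*} (z : ℂ) (M : Matrix P Q (RatFunc ℂ)) : Prop :=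
  ∀ i j, M i j ∈ regularAt z

/-- The value of a rational matrix at a point. -/
def matEval {P Q : Type*} (z : ℂ) (M : Matrix P Q (RatFunc ℂ)) : Matrix P Q ℂ :=
  M.map (RatFunc.eval (RingHom.id ℂ) z)

theorem onCircle_eq_matEval {p q : ℕ} (M : Matrix (Fin p) (Fin q) (RatFunc ℂ)) (z : Circle) :
    onCircle M z = matEval z M := rfl

namespace IsRegularAt

variable {P Q S : Type*} {z : ℂ}

/-- A matrix that is regular at `z`, over the ring of functions regular at `z`. -/
def lift {M : Matrix P Q (RatFunc ℂ)} (h : IsRegularAt z M) : Matrix P Q (regularAt z) :=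
  Matrix.of fun i j => ⟨M i j, h i j⟩

theorem map_lift {M : Matrix P Q (RatFunc ℂ)} (h : IsRegularAt z M) :
    h.lift.map (regularAt z).subtype = M := rfl

theorem map_evalAt_lift {M : Matrix P Q (RatFunc ℂ)} (h : IsRegularAt z M) :
    h.lift.map (evalAt z) = matEval z M := rfl

theorem map_subtype (L : Matrix P Q (regularAt z)) : IsRegularAt z (L.map (regularAt z).subtype) :=
  fun i j => (L i j).2

theorem matEval_map_subtype (L : Matrix P Q (regularAt z)) :
    matEval z (L.map (regularAt z).subtype) = L.map (evalAt z) := rfl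

theorem add {M N : Matrix P Q (RatFunc ℂ)} (hM : IsRegularAt z M) (hN : IsRegularAt z N) :
    IsRegularAt z (M + N) ∧ matEval z (M + N) = matEval z M + matEval z N :=
  ⟨fun i j => add_mem (hM i j) (hN i j),
    Matrix.ext fun i j => RatFunc.eval_add _ _ (hM i j) (hN i j)⟩

theorem mul [Fintype Q] {M : Matrix P Q (RatFunc ℂ)} {N : Matrix Q S (RatFunc ℂ)}
    (hM : IsRegularAt z M) (hN : IsRegularAt z N) :
    IsRegularAt z (M * N) ∧ matEval z (M * N) = matEval z M * matEval z N := by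
  have h : M * N = (hM.lift * hN.lift).map (regularAt z).subtype := by
    rw [Matrix.map_mul, map_lift, map_lift]
  rw [h]
  refine ⟨map_subtype _, ?_⟩
  rw [matEval_map_subtype, Matrix.map_mul, map_evalAt_lift, map_evalAt_lift]

theorem const (M : Matrix P Q ℂ) :
    IsRegularAt z (M.map RatFunc.C) ∧ matEval z (M.map RatFunc.C) = M :=
  ⟨fun i j => C_mem_regularAt _ _, Matrix.ext fun i j => by simp [matEval]⟩

theorem scalar_sub_const [Fintype P] [DecidableEq P] {f : RatFunc ℂ} (hf : f ∈ regularAt z)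
    (M : Matrix P P ℂ) :
    IsRegularAt z (Matrix.scalar P f - M.map RatFunc.C) ∧
      matEval z (Matrix.scalar P f - M.map RatFunc.C) =
        Matrix.scalar P (RatFunc.eval (RingHom.id ℂ) z f) - M := by
  have h : Matrix.scalar P f - M.map RatFunc.C = (Matrix.scalar P (⟨f, hf⟩ : regularAt z) -
      M.map fun c => (⟨RatFunc.C c, C_mem_regularAt z c⟩ : regularAt z)).map
        (regularAt z).subtype := by
    ext i j
    by_cases h : i = j
    · subst h; simp
    · simp [h]
  rw [h]
  refine ⟨map_subtype _, ?_⟩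
  rw [matEval_map_subtype]
  have hf' : evalAt z ⟨f, hf⟩ = RatFunc.eval (RingHom.id ℂ) z f := rfl
  have hC : ∀ c, evalAt z ⟨RatFunc.C c, C_mem_regularAt z c⟩ = c := fun c => RatFunc.eval_C _ _
  ext i j
  by_cases h : i = j
  · subst h; simp [hf', hC]
  · simp [h, hC]

theorem inv [Fintype P] [DecidableEq P] {M : Matrix P P (RatFunc ℂ)} (hM : IsRegularAt z M)
    (hdet : (matEval z M).det ≠ 0) :
    IsRegularAt z M⁻¹ ∧ matEval z M⁻¹ = (matEval z M)⁻¹ := by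
  have hd : M.det = (regularAt z).subtype hM.lift.det := by
    rw [RingHom.map_det]
    rfl
  have hd' : RatFunc.eval (RingHom.id ℂ) z M.det = (matEval z M).det := by
    rw [hd, ← map_evalAt_lift hM]
    exact RingHom.map_det (evalAt z) hM.lift
  have hdet0 : M.det ≠ 0 := by
    intro h
    rw [h] at hd'
    exact hdet (by rw [← hd', RatFunc.eval_zero])
  have hreg : IsRegularAt z M⁻¹ := by
    rw [Matrix.inv_def, Ring.inverse_eq_inv']
    intro i j
    rw [Matrix.smul_apply, smul_eq_mul]
    refine mul_mem (inv_mem_regularAt (by rwa [hd'])) ?_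
    have hadj : M.adjugate = hM.lift.adjugate.map (regularAt z).subtype := by
      have h1 := RingHom.map_adjugate (regularAt z).subtype hM.lift
      exact h1.symm
    rw [hadj]
    exact map_subtype _ i j
  refine ⟨hreg, ?_⟩
  symm
  apply Matrix.inv_eq_right_inv
  rw [← (hM.mul hreg).2, Matrix.mul_nonsing_inv _ (isUnit_iff_ne_zero.2 hdet0)]
  have h1 := (const (z := z) (1 : Matrix P P ℂ)).2
  rwa [Matrix.map_one _ (map_zero _) (map_one _)] at h1

end IsRegularAt

/-! ## Almost every point of the circle -/

theorem AECircle.and {p q : Circle → Prop} (hp : AECircle p) (hq : AECircle q) :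
    AECircle fun z => p z ∧ q z := Filter.Eventually.and hp hq

theorem AECircle.mono {p q : Circle → Prop} (hp : AECircle p) (h : ∀ z, p z → q z) :
    AECircle q := Filter.Eventually.mono hp fun _ => h _

/-- `Circle.exp` is injective on `(-π, π]`, so finitely many points have finitely many angles. -/
theorem aeCircle_notMem_finset (s : Finset ℂ) : AECircle fun z => (z : ℂ) ∉ s := by
  rw [AECircle, ae_restrict_iff' measurableSet_Ioc]
  have hfin : {θ | θ ∈ Set.Ioc (-Real.pi) Real.pi ∧ (Circle.exp θ : ℂ) ∈ s}.Finite := by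
    refine Set.Finite.of_finite_image (f := fun θ => (Circle.exp θ : ℂ))
      (s.finite_toSet.subset ?_) ?_
    · rintro _ ⟨θ, hθ, rfl⟩
      exact hθ.2
    · intro x hx y hy hxy
      exact Circle.exp_injOn_Ioc (by linarith) hx.1 hy.1 (Circle.ext hxy)
  filter_upwards [compl_mem_ae_iff.2 (hfin.measure_zero volume)] with θ hθ hI hs
  exact hθ ⟨hI, hs⟩

theorem aeCircle_isRegularAt {p q : ℕ} (M : Matrix (Fin p) (Fin q) (RatFunc ℂ)) :
    AECircle fun z => IsRegularAt z M := by
  classical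
  refine (aeCircle_notMem_finset (Finset.univ.biUnion fun s : Fin p × Fin q =>
    (M s.1 s.2).denom.roots.toFinset)).mono fun z hz i j h => hz ?_
  rw [Finset.mem_biUnion]
  exact ⟨(i, j), Finset.mem_univ _, by
    rw [Multiset.mem_toFinset, Polynomial.mem_roots (RatFunc.denom_ne_zero _)]; exact h⟩

/-! ## The transfer function on the circle -/

theorem det_scalar_sub_ne_zero {n : ℕ} {A : Matrix (Fin n) (Fin n) ℝ}
    (hA : ∀ a : ℂ, (A.map Complex.ofReal).charpoly.IsRoot a → ‖a‖ < 1) (z : Circle) :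
    (Matrix.scalar (Fin n) (z : ℂ) - A.map Complex.ofReal).det ≠ 0 := by
  intro h
  have h1 := hA z (by rw [Polynomial.IsRoot.def, Matrix.eval_charpoly, h])
  rw [Circle.norm_coe] at h1
  exact lt_irrefl _ h1

theorem onCircle_transferFunction {n m : ℕ} {A : Matrix (Fin n) (Fin n) ℝ}
    (hA : ∀ a : ℂ, (A.map Complex.ofReal).charpoly.IsRoot a → ‖a‖ < 1)
    (B : Matrix (Fin n) (Fin m) ℝ) (z : Circle) :
    IsRegularAt z (transferFunction A B) ∧ onCircle (transferFunction A B) z =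
      (Matrix.scalar (Fin n) (z : ℂ) - A.map Complex.ofReal)⁻¹ * B.map Complex.ofReal := by
  have h1 := IsRegularAt.scalar_sub_const (X_mem_regularAt z) (A.map Complex.ofReal)
  rw [RatFunc.eval_X] at h1
  have h2 := h1.1.inv (by rw [h1.2]; exact det_scalar_sub_ne_zero hA z)
  have h3 := h2.1.mul (IsRegularAt.const (B.map Complex.ofReal)).1
  rw [onCircle_eq_matEval, transferFunction_eq]
  refine ⟨h3.1, ?_⟩
  rw [h3.2, h2.2, h1.2, (IsRegularAt.const _).2]

/-- The rational matrix `G*(z) = G(z⁻¹)ᵀ`. -/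
def conjTransferFunction {n m : ℕ} (A : Matrix (Fin n) (Fin n) ℝ) (B : Matrix (Fin n) (Fin m) ℝ) :
    Matrix (Fin m) (Fin n) (RatFunc ℂ) :=
  ((B.map Complex.ofReal)ᵀ).map RatFunc.C *
    (Matrix.scalar (Fin n) (RatFunc.X)⁻¹ - ((A.map Complex.ofReal)ᵀ).map RatFunc.C)⁻¹

theorem mcmillanDegree_conjTransferFunction_le {n m : ℕ} (A : Matrix (Fin n) (Fin n) ℝ)
    (B : Matrix (Fin n) (Fin m) ℝ) : mcmillanDegree (conjTransferFunction A B) ≤ n := by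
  refine (mcmillanDegree_mul_le _ _).trans ?_
  rw [mcmillanDegree_map_C, zero_add]
  exact (mcmillanDegree_inv_le _).trans (mcmillanDegree_X_inv_sub_le _)

theorem conjTranspose_map_ofReal {p q : ℕ} (M : Matrix (Fin p) (Fin q) ℝ) :
    (M.map Complex.ofReal)ᴴ = (M.map Complex.ofReal)ᵀ := by
  ext i j
  simp

/-- On the circle `z⁻¹` is the conjugate of `z`, and `A`, `B` are real. -/
theorem onCircle_conjTransferFunction {n m : ℕ} {A : Matrix (Fin n) (Fin n) ℝ}
    (hA : ∀ a : ℂ, (A.map Complex.ofReal).charpoly.IsRoot a → ‖a‖ < 1)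
    (B : Matrix (Fin n) (Fin m) ℝ) (z : Circle) :
    IsRegularAt z (conjTransferFunction A B) ∧ onCircle (conjTransferFunction A B) z =
      (onCircle (transferFunction A B) z)ᴴ := by
  have hz : (RatFunc.X)⁻¹ ∈ regularAt (z : ℂ) :=
    inv_mem_regularAt (by rw [RatFunc.eval_X]; exact Circle.coe_ne_zero z)
  have hze : RatFunc.eval (RingHom.id ℂ) (z : ℂ) (RatFunc.X)⁻¹ = star (z : ℂ) := by
    have h1 : (evalAt z) ⟨_, hz⟩ * evalAt z ⟨_, X_mem_regularAt z⟩ = 1 := by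
      rw [← map_mul, ← map_one (evalAt (z : ℂ))]
      congr 1
      exact Subtype.ext (inv_mul_cancel₀ RatFunc.X_ne_zero)
    have h2 : (evalAt z) ⟨_, X_mem_regularAt z⟩ = (z : ℂ) := RatFunc.eval_X _ _
    rw [h2] at h1
    have h3 : star (z : ℂ) = (z : ℂ)⁻¹ := by
      rw [← Circle.coe_inv, Circle.coe_inv_eq_conj]
      rfl
    rw [h3]
    exact eq_inv_of_mul_eq_one_left h1
  have h1 := IsRegularAt.scalar_sub_const hz (A.map Complex.ofReal)ᵀ
  have h4 : Matrix.scalar (Fin n) (star (z : ℂ)) - (A.map Complex.ofReal)ᵀ =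
      (Matrix.scalar (Fin n) (z : ℂ) - A.map Complex.ofReal)ᴴ := by
    rw [Matrix.conjTranspose_sub, conjTranspose_map_ofReal]
    congr 1
    ext i j
    by_cases h : i = j
    · subst h; simp
    · simp [h, Ne.symm h]
  rw [hze, h4] at h1
  have h2 := h1.1.inv (by
    rw [h1.2, Matrix.det_conjTranspose]
    exact star_ne_zero.2 (det_scalar_sub_ne_zero hA z))
  have h3 := (IsRegularAt.const (z := z) (B.map Complex.ofReal)ᵀ).1.mul h2.1
  refine ⟨h3.1, ?_⟩
  rw [onCircle_eq_matEval, (onCircle_transferFunction hA B z).2, conjTransferFunction,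
    h3.2, h2.2, h1.2, (IsRegularAt.const _).2, Matrix.conjTranspose_mul,
    Matrix.conjTranspose_nonsing_inv, conjTranspose_map_ofReal]

/-- The approximants are rational, of degree at most `deg Ψ + 2 n`. -/
theorem isRationalOfDegreeLE_approximant {n m : ℕ} {A : Matrix (Fin n) (Fin n) ℝ}
    (hA : ∀ a : ℂ, (A.map Complex.ofReal).charpoly.IsRoot a → ‖a‖ < 1)
    (B : Matrix (Fin n) (Fin m) ℝ) {Ψ : Matrix (Fin m) (Fin m) (RatFunc ℂ)}
    (hΨ : AECircle fun z => (onCircle Ψ z).PosDef) {Λ : Matrix (Fin n) (Fin n) ℝ}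
    (hΛ : IsMultiplier (onCircle (transferFunction A B)) (onCircle Ψ) Λ) :
    IsRationalOfDegreeLE (approximant (onCircle (transferFunction A B)) (onCircle Ψ) Λ)
      (mcmillanDegree Ψ + 2 * n) := by
  refine ⟨(Ψ⁻¹ + conjTransferFunction A B * ((Λ.map Complex.ofReal).map RatFunc.C) *
    transferFunction A B)⁻¹, ?_, ?_⟩
  -- Almost everywhere `Ψ` has no pole and both matrices to be inverted are positive definite, so
  -- evaluation commutes with all operations.
  · refine ((hΨ.and hΛ.2).and (aeCircle_isRegularAt Ψ)).mono fun z hz => ?_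
    obtain ⟨⟨h1, h2⟩, h3⟩ := hz
    have hΨi := h3.inv h1.det_pos.ne'
    have hG := onCircle_transferFunction hA B z
    have hGs := onCircle_conjTransferFunction hA B z
    have hL := IsRegularAt.const (z := z) (Λ.map Complex.ofReal)
    have h4 := hGs.1.mul hL.1
    have h5 := h4.1.mul hG.1
    have h6 := hΨi.1.add h5.1
    have h7 : matEval z (Ψ⁻¹ + conjTransferFunction A B * ((Λ.map Complex.ofReal).map RatFunc.C) *
        transferFunction A B) =
        inverseApproximant (onCircle (transferFunction A B)) (onCircle Ψ) Λ z := by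
      rw [h6.2, h5.2, h4.2, hL.2, hΨi.2, inverseApproximant, ← hGs.2]
      rfl
    rw [onCircle_eq_matEval, (h6.1.inv (by rw [h7]; exact h2.det_pos.ne')).2, h7, approximant]
  · refine (mcmillanDegree_inv_le _).trans ((mcmillanDegree_add_le _ _).trans ?_)
    have h1 := mcmillanDegree_inv_le Ψ
    have h2 := mcmillanDegree_mul_le (conjTransferFunction A B *
      ((Λ.map Complex.ofReal).map RatFunc.C)) (transferFunction A B)
    have h3 := mcmillanDegree_mul_le (conjTransferFunction A B)
      ((Λ.map Complex.ofReal).map RatFunc.C)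
    rw [mcmillanDegree_map_C] at h3
    have h4 := mcmillanDegree_conjTransferFunction_le A B
    have h5 := mcmillanDegree_transferFunction_le A B
    omega

/-! ## Positive semidefinite bilinear forms -/

/-- Projection onto the image of a finite-dimensional space for a positive semidefinite form. -/
theorem LinearMap.BilinForm.exists_forall_sub_apply_eq_zero {W L : Type*} [AddCommGroup W]
    [Module ℝ W] [AddCommGroup L] [Module ℝ L] [FiniteDimensional ℝ L]
    (b : LinearMap.BilinForm ℝ W) (hs : ∀ x, 0 ≤ b x x) (hb : ∀ x y, b x y = b y x) (J : L →ₗ[ℝ] W) (h : W) :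
    ∃ v : L, ∀ u : L, b (h - J v) (J u) = 0 := by
  let T : L →ₗ[ℝ] Module.Dual ℝ L := (b.compl₁₂ J J)
  have hT : ∀ u v, T u v = b (J u) (J v) := fun _ _ => rfl
  let φ : Module.Dual ℝ L := (b h).comp J
  -- The form may be degenerate. If `T w = 0` then `b (J w) (J w) = 0`, and semidefiniteness makes
  -- `J w` orthogonal to everything, so `φ` kills the kernel of `T` and lies in the range of its
  -- dual map; reflexivity of `L` then yields `v`.
  have hφ : φ ∈ (LinearMap.ker T).dualAnnihilator := by
    rw [Submodule.mem_dualAnnihilator]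
    intro w hw
    have h1 : b (J w) (J w) = 0 := by rw [← hT, LinearMap.mem_ker.1 hw, LinearMap.zero_apply]
    have h2 := (LinearMap.BilinForm.apply_apply_same_eq_zero_iff b hs ⟨hb⟩).1 h1
    have h3 : b (J w) h = 0 := by rw [LinearMap.mem_ker.1 h2, LinearMap.zero_apply]
    change b h (J w) = 0
    rw [hb, h3]
  rw [← LinearMap.range_dualMap_eq_dualAnnihilator_ker] at hφ
  obtain ⟨ξ, hξ⟩ := hφ
  obtain ⟨v, rfl⟩ := (Module.evalEquiv ℝ L).surjective ξ
  refine ⟨v, fun u => ?_⟩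
  have h5 := LinearMap.congr_fun hξ u
  have h6 : b (J u) (J v) = b h (J u) := h5
  rw [map_sub, LinearMap.sub_apply, hb (J v), h6, sub_self]

/-! ## Pointwise matrix estimates -/

namespace Matrix

variable {p q r : ℕ}

theorem norm_mul_apply_le {X : Matrix (Fin p) (Fin q) ℂ} {Y : Matrix (Fin q) (Fin r) ℂ} {K L : ℝ}
    (hX : ∀ i j, ‖X i j‖ ≤ K) (hY : ∀ i j, ‖Y i j‖ ≤ L) (i : Fin p) (j : Fin r) :
    ‖(X * Y) i j‖ ≤ q * (K * L) := by
  rw [mul_apply]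
  refine (norm_sum_le_of_le (n := fun _ => K * L) _ fun k _ => ?_).trans_eq (by simp)
  rw [norm_mul]
  exact mul_le_mul (hX i k) (hY k j) (norm_nonneg _) ((norm_nonneg _).trans (hX i k))

theorem norm_trace_le {X : Matrix (Fin p) (Fin p) ℂ} {K : ℝ} (hX : ∀ i j, ‖X i j‖ ≤ K) :
    ‖X.trace‖ ≤ p * K := by
  rw [trace]
  exact (norm_sum_le_of_le (n := fun _ => K) _ fun k _ => hX k k).trans_eq (by simp)

theorem norm_det_le {X : Matrix (Fin p) (Fin p) ℂ} {K : ℝ} (hX : ∀ i j, ‖X i j‖ ≤ K) :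
    ‖X.det‖ ≤ p.factorial * K ^ p := by
  have h := Matrix.det_le (A := X) (abv := NormedField.toAbsoluteValue ℂ) (x := K) hX
  rw [Fintype.card_fin, nsmul_eq_mul] at h
  exact h

theorem star_dotProduct_self_eq (x : Fin p → ℂ) :
    star x ⬝ᵥ x = ((∑ i, ‖x i‖ ^ 2 : ℝ) : ℂ) := by
  simp [dotProduct, Complex.conj_mul']

theorem norm_star_dotProduct_mulVec_le {F : Matrix (Fin p) (Fin p) ℂ} {K : ℝ}
    (hF : ∀ i j, ‖F i j‖ ≤ K) (hK : 0 ≤ K) (x : Fin p → ℂ) :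
    ‖star x ⬝ᵥ F *ᵥ x‖ ≤ p * K * ∑ i, ‖x i‖ ^ 2 := by
  have h1 : ‖star x ⬝ᵥ F *ᵥ x‖ ≤ K * (∑ i, ‖x i‖) ^ 2 := by
    rw [sq, Finset.sum_mul_sum, dotProduct, Finset.mul_sum]
    refine (norm_sum_le _ _).trans (Finset.sum_le_sum fun i _ => ?_)
    rw [mulVec, dotProduct, Finset.mul_sum, Finset.mul_sum]
    refine (norm_sum_le _ _).trans (Finset.sum_le_sum fun j _ => ?_)
    rw [norm_mul, norm_mul, Pi.star_apply, norm_star]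
    have := mul_le_mul_of_nonneg_right (hF i j)
      (mul_nonneg (norm_nonneg (x i)) (norm_nonneg (x j)))
    linarith
  have h2 := sq_sum_le_card_mul_sum_sq (s := Finset.univ) (f := fun i => ‖x i‖)
  rw [Finset.card_univ, Fintype.card_fin] at h2
  calc _ ≤ _ := h1
    _ ≤ K * (p * ∑ i, ‖x i‖ ^ 2) := mul_le_mul_of_nonneg_left h2 hK
    _ = _ := by ring

theorem smul_one_isHermitian (c : ℝ) :
    ((c : ℂ) • (1 : Matrix (Fin p) (Fin p) ℂ)).IsHermitian := by
  rw [IsHermitian, conjTranspose_smul, conjTranspose_one]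
  simp

/-- A Hermitian matrix is bounded by a multiple of the identity. -/
theorem IsHermitian.posSemidef_smul_one_sub {F : Matrix (Fin p) (Fin p) ℂ} (h : F.IsHermitian)
    {K c : ℝ} (hF : ∀ i j, ‖F i j‖ ≤ K) (hK : 0 ≤ K) (hc : p * K ≤ c) :
    ((c : ℂ) • (1 : Matrix (Fin p) (Fin p) ℂ) - F).PosSemidef := by
  refine PosSemidef.of_dotProduct_mulVec_nonneg ((smul_one_isHermitian c).sub h) fun x => ?_
  have h1 := norm_star_dotProduct_mulVec_le hF hK x
  have h2 : (star x ⬝ᵥ F *ᵥ x).im = 0 := h.im_star_dotProduct_mulVec_self x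
  have h3 : star x ⬝ᵥ ((c : ℂ) • (1 : Matrix (Fin p) (Fin p) ℂ) - F) *ᵥ x =
      ((c * ∑ i, ‖x i‖ ^ 2 : ℝ) : ℂ) - star x ⬝ᵥ F *ᵥ x := by
    rw [sub_mulVec, dotProduct_sub, smul_mulVec, one_mulVec, dotProduct_smul,
      star_dotProduct_self_eq]
    simp
  rw [h3, Complex.nonneg_iff]
  have h4 : p * K * ∑ i, ‖x i‖ ^ 2 ≤ c * ∑ i, ‖x i‖ ^ 2 :=
    mul_le_mul_of_nonneg_right hc (Finset.sum_nonneg fun i _ => sq_nonneg _)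
  constructor
  · rw [Complex.sub_re, Complex.ofReal_re]
    linarith [Complex.re_le_norm (star x ⬝ᵥ F *ᵥ x)]
  · rw [Complex.sub_im, Complex.ofReal_im, h2, sub_zero]

theorem PosSemidef.exists_eq_conjTranspose_mul_self {M : Matrix (Fin p) (Fin p) ℂ}
    (h : M.PosSemidef) : ∃ B : Matrix (Fin p) (Fin p) ℂ, M = Bᴴ * B := by
  open scoped MatrixOrder in
  obtain ⟨B, hB⟩ := CStarAlgebra.nonneg_iff_eq_star_mul_self.mp h.nonneg
  exact ⟨B, hB⟩

/-- With `M = Bᴴ B` the entries are inner products of columns of `B`, whose squared norms form the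
diagonal. -/
theorem PosSemidef.norm_apply_le {M : Matrix (Fin p) (Fin p) ℂ} (h : M.PosSemidef) {c : ℝ}
    (hc : ∀ i, (M i i).re ≤ c) (i j : Fin p) : ‖M i j‖ ≤ c := by
  obtain ⟨B, rfl⟩ := h.exists_eq_conjTranspose_mul_self
  have hd : ∀ i, ((Bᴴ * B) i i).re = ∑ k, ‖B k i‖ ^ 2 := by
    intro i
    rw [mul_apply, Complex.re_sum]
    refine Finset.sum_congr rfl fun k _ => ?_
    rw [conjTranspose_apply]
    change (starRingEnd ℂ (B k i) * B k i).re = _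
    rw [Complex.conj_mul']
    norm_cast
  have h1 : ‖(Bᴴ * B) i j‖ ≤ ∑ k, (‖B k i‖ ^ 2 + ‖B k j‖ ^ 2) / 2 := by
    rw [mul_apply]
    refine (norm_sum_le _ _).trans (Finset.sum_le_sum fun k _ => ?_)
    rw [norm_mul, conjTranspose_apply, norm_star]
    nlinarith [sq_nonneg (‖B k i‖ - ‖B k j‖)]
  rw [← Finset.sum_div, Finset.sum_add_distrib, ← hd, ← hd] at h1
  linarith [hc i, hc j]

theorem posDef_of_sub_smul_one {M : Matrix (Fin p) (Fin p) ℂ} {α : ℝ} (hα : 0 ≤ α)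
    (h : (M - (α : ℂ) • (1 : Matrix (Fin p) (Fin p) ℂ)).PosDef) : M.PosDef := by
  have h1 := h.add_posSemidef (PosSemidef.one.smul (Complex.zero_le_real.2 hα))
  rwa [sub_add_cancel] at h1

/-- The inverse of a coercive matrix is bounded. -/
theorem norm_inv_apply_le {M : Matrix (Fin p) (Fin p) ℂ} {α : ℝ} (hα : 0 < α)
    (h : (M - (α : ℂ) • (1 : Matrix (Fin p) (Fin p) ℂ)).PosDef) (i j : Fin p) :
    ‖M⁻¹ i j‖ ≤ α⁻¹ := by
  have hM := posDef_of_sub_smul_one hα.le h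
  have hu : IsUnit M.det := isUnit_iff_ne_zero.2 hM.det_pos.ne'
  refine hM.inv.posSemidef.norm_apply_le (fun i => ?_) i j
  -- For this column of `M⁻¹`, coercivity tested on `y` gives `α ‖y‖² ≤ re (y i)`, whence `re (y i)
  -- ≤ α⁻¹`.
  set y := M⁻¹ *ᵥ Pi.single i 1 with hy
  have hMy : M *ᵥ y = Pi.single i 1 := by
    rw [hy, mulVec_mulVec, mul_nonsing_inv _ hu, one_mulVec]
  have hyi : y i = M⁻¹ i i := by simp [hy]
  have h1 := (Complex.nonneg_iff.1 (h.posSemidef.dotProduct_mulVec_nonneg y)).1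
  rw [sub_mulVec, dotProduct_sub, smul_mulVec, one_mulVec, dotProduct_smul, hMy,
    star_dotProduct_self_eq] at h1
  have h2 : (star y ⬝ᵥ Pi.single i (1 : ℂ)).re = (y i).re := by simp
  rw [Complex.sub_re, h2, smul_eq_mul, Complex.re_ofReal_mul, Complex.ofReal_re] at h1
  have h3 : ‖y i‖ ^ 2 ≤ ∑ k, ‖y k‖ ^ 2 :=
    Finset.single_le_sum (f := fun k => ‖y k‖ ^ 2) (fun k _ => sq_nonneg _) (Finset.mem_univ i)
  rw [← hyi]
  have h4 := Complex.abs_re_le_norm (y i)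
  have h5 : (y i).re ^ 2 ≤ ‖y i‖ ^ 2 := by
    rw [← sq_abs (y i).re]
    exact pow_le_pow_left₀ (abs_nonneg _) h4 2
  by_contra! hlt
  have hpos : 0 < (y i).re := (inv_pos.2 hα).trans hlt
  have h6 : 1 < α * (y i).re := by
    have := mul_lt_mul_of_pos_left hlt hα
    rwa [mul_inv_cancel₀ hα.ne'] at this
  nlinarith [mul_le_mul_of_nonneg_left (h5.trans h3) hα.le]

theorem PosDef.log_det_le {M : Matrix (Fin p) (Fin p) ℂ} (h : M.PosDef) :
    Real.log M.det.re ≤ M.trace.re - p := by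
  have h1 : M.det.re = ∏ i, h.1.eigenvalues i := by
    rw [h.1.det_eq_prod_eigenvalues]
    norm_cast
  have h2 : M.trace.re = ∑ i, h.1.eigenvalues i := by
    rw [h.1.trace_eq_sum_eigenvalues]
    norm_cast
  rw [h1, h2, Real.log_prod fun i _ => (h.eigenvalues_pos i).ne']
  calc _ ≤ ∑ i, (h.1.eigenvalues i - 1) :=
        Finset.sum_le_sum fun i _ => Real.log_le_sub_one_of_pos (h.eigenvalues_pos i)
    _ = _ := by simp

/-- `P * Q` need not be Hermitian, but for `P = Bᴴ B` it shares determinant and trace with `B Q Bᴴ`.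
-/
theorem PosDef.log_det_mul_le {P Q : Matrix (Fin p) (Fin p) ℂ} (hP : P.PosDef) (hQ : Q.PosDef) :
    Real.log (P * Q).det.re ≤ (P * Q).trace.re - p := by
  obtain ⟨B, rfl⟩ := hP.posSemidef.exists_eq_conjTranspose_mul_self
  have hB : IsUnit B := by
    rw [isUnit_iff_isUnit_det, isUnit_iff_ne_zero]
    intro h0
    have := hP.det_pos.ne'
    rw [det_mul, h0, mul_zero] at this
    exact this rfl
  have h1 : (B * Q * Bᴴ).PosDef := (IsUnit.posDef_star_right_conjugate_iff hB).2 hQ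
  have h2 := h1.log_det_le
  have hd : (B * Q * Bᴴ).det = (Bᴴ * B * Q).det := by
    simp only [det_mul]
    ring
  have ht : (B * Q * Bᴴ).trace = (Bᴴ * B * Q).trace := by
    rw [trace_mul_comm, Matrix.mul_assoc]
  rwa [hd, ht] at h2

theorem PosDef.det_mul_pos {P Q : Matrix (Fin p) (Fin p) ℂ} (hP : P.PosDef) (hQ : Q.PosDef) :
    0 < (P * Q).det.re ∧ (P * Q).det.im = 0 := by
  have h := mul_pos hP.det_pos hQ.det_pos
  rw [← det_mul, Complex.pos_iff] at h
  exact ⟨h.1, h.2.symm⟩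

/-- Concavity of `log det`, with the tangent taken at `P`: an upper bound for the perturbed value.
-/
theorem PosDef.log_det_inv_mul_le {P Q R : Matrix (Fin p) (Fin p) ℂ} (hP : P.PosDef)
    (hQ : Q.PosDef) (hR : R.PosDef) :
    Real.log (P⁻¹ * R).det.re ≤ Real.log (Q⁻¹ * R).det.re + ((P⁻¹ * Q).trace.re - p) := by
  have h1 := hP.inv.log_det_mul_le hQ
  have h2 := hP.inv.det_mul_pos hQ
  have h3 := hQ.inv.det_mul_pos hR
  have h4 : (P⁻¹ * R).det.re = (P⁻¹ * Q).det.re * (Q⁻¹ * R).det.re := by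
    have h5 : P⁻¹ * R = (P⁻¹ * Q) * (Q⁻¹ * R) := by
      rw [Matrix.mul_assoc, mul_nonsing_inv_cancel_left _ _ (isUnit_iff_ne_zero.2 hQ.det_pos.ne')]
    rw [h5, det_mul, Complex.mul_re, h2.2, h3.2]
    ring
  rw [h4, Real.log_mul h2.1.ne' h3.1.ne']
  linarith

/-- The two determinants are reciprocal, so `log x ≤ x - 1` bounds the logarithm from both sides. -/
theorem PosDef.abs_log_det_inv_mul_le {P R : Matrix (Fin p) (Fin p) ℂ} (hP : P.PosDef)
    (hR : R.PosDef) {K L : ℝ} (hK : ‖(P⁻¹ * R).det‖ ≤ K) (hL : ‖(R⁻¹ * P).det‖ ≤ L) :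
    |Real.log (P⁻¹ * R).det.re| ≤ K + L := by
  have h1 := hP.inv.det_mul_pos hR
  have h2 := hR.inv.det_mul_pos hP
  have h3 : (P⁻¹ * R).det.re * (R⁻¹ * P).det.re = 1 := by
    have h4 : (P⁻¹ * R) * (R⁻¹ * P) = 1 := by
      rw [Matrix.mul_assoc, mul_nonsing_inv_cancel_left _ _ (isUnit_iff_ne_zero.2 hR.det_pos.ne'),
        nonsing_inv_mul _ (isUnit_iff_ne_zero.2 hP.det_pos.ne')]
    have h5 := congrArg (fun M => (det M).re) h4
    simp only [det_one, Complex.one_re] at h5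
    rwa [det_mul, Complex.mul_re, h1.2, h2.2, mul_zero, sub_zero] at h5
  have h6 := Real.log_le_sub_one_of_pos h1.1
  have h7 := Real.log_le_sub_one_of_pos h2.1
  have h8 : Real.log (R⁻¹ * P).det.re = -Real.log (P⁻¹ * R).det.re := by
    rw [← Real.log_inv, ← eq_inv_of_mul_eq_one_right h3]
  have h9 := Complex.re_le_norm (P⁻¹ * R).det
  have h10 := Complex.re_le_norm (R⁻¹ * P).det
  rw [abs_le]
  constructor <;> linarith [norm_nonneg (P⁻¹ * R).det, norm_nonneg (R⁻¹ * P).det]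

end Matrix

/-! ## Essentially bounded matrix functions on the circle -/

/-- Lebesgue measure on the interval `(-π, π]` of angles. -/
abbrev angleMeasure : Measure ℝ := volume.restrict (Set.Ioc (-Real.pi) Real.pi)

/-- Measurable and essentially bounded matrix functions on the circle. -/
def IsEssBounded {p q : ℕ} (F : Circle → Matrix (Fin p) (Fin q) ℂ) : Prop :=
  (∀ i j, AEMeasurable (fun θ : ℝ => F (Circle.exp θ) i j) angleMeasure) ∧
    ∃ K : ℝ, 0 ≤ K ∧ AECircle fun z => ∀ i j, ‖F z i j‖ ≤ K

namespace IsEssBounded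

variable {p q r : ℕ}

theorem of_bound {F : Circle → Matrix (Fin p) (Fin q) ℂ}
    (hm : ∀ i j, AEMeasurable (fun θ : ℝ => F (Circle.exp θ) i j) angleMeasure) (K : ℝ)
    (hK : AECircle fun z => ∀ i j, ‖F z i j‖ ≤ K) : IsEssBounded F :=
  ⟨hm, max K 0, le_max_right _ _, hK.mono fun _ h i j => (h i j).trans (le_max_left _ _)⟩

theorem aemeasurable_comp {F : Circle → Matrix (Fin p) (Fin q) ℂ} (hF : IsEssBounded F)
    {g : Matrix (Fin p) (Fin q) ℂ → ℂ} (hg : Continuous g) :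
    AEMeasurable (fun θ : ℝ => g (F (Circle.exp θ))) angleMeasure := by
  have h1 : AEMeasurable (fun θ : ℝ => (fun i j => F (Circle.exp θ) i j : Fin p → Fin q → ℂ))
      angleMeasure :=
    aemeasurable_pi_lambda _ fun i => aemeasurable_pi_lambda _ fun j => hF.1 i j
  have hg' : Continuous fun M : Fin p → Fin q → ℂ => g (Matrix.of M) := hg
  exact hg'.measurable.comp_aemeasurable h1

theorem add {F K : Circle → Matrix (Fin p) (Fin q) ℂ} (hF : IsEssBounded F)
    (hK : IsEssBounded K) : IsEssBounded fun z => F z + K z := by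
  obtain ⟨a, -, ha⟩ := hF.2
  obtain ⟨b, -, hb⟩ := hK.2
  refine of_bound (fun i j => (hF.1 i j).add (hK.1 i j)) (a + b) ((ha.and hb).mono ?_)
  exact fun z h i j => (norm_add_le _ _).trans (add_le_add (h.1 i j) (h.2 i j))

theorem smul {F : Circle → Matrix (Fin p) (Fin q) ℂ} (c : ℝ) (hF : IsEssBounded F) :
    IsEssBounded fun z => c • F z := by
  obtain ⟨a, -, ha⟩ := hF.2
  refine of_bound (fun i j => (hF.1 i j).const_smul c) (|c| * a) (ha.mono fun z h i j => ?_)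
  rw [Matrix.smul_apply, norm_smul, Real.norm_eq_abs]
  exact mul_le_mul_of_nonneg_left (h i j) (abs_nonneg c)

theorem sub {F K : Circle → Matrix (Fin p) (Fin q) ℂ} (hF : IsEssBounded F)
    (hK : IsEssBounded K) : IsEssBounded fun z => F z - K z := by
  have h := hF.add (hK.smul (-1))
  simpa [sub_eq_add_neg] using h

theorem mul {F : Circle → Matrix (Fin p) (Fin q) ℂ} {K : Circle → Matrix (Fin q) (Fin r) ℂ}
    (hF : IsEssBounded F) (hK : IsEssBounded K) : IsEssBounded fun z => F z * K z := by
  obtain ⟨a, -, ha⟩ := hF.2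
  obtain ⟨b, -, hb⟩ := hK.2
  refine of_bound (fun i j => ?_) (q * (a * b)) ((ha.and hb).mono ?_)
  · simp_rw [Matrix.mul_apply]
    exact Finset.aemeasurable_fun_sum _ fun k _ => (hF.1 i k).mul (hK.1 k j)
  · exact fun z h i j => Matrix.norm_mul_apply_le h.1 h.2 i j

theorem conjTranspose {F : Circle → Matrix (Fin p) (Fin q) ℂ} (hF : IsEssBounded F) :
    IsEssBounded fun z => (F z)ᴴ := by
  obtain ⟨a, -, ha⟩ := hF.2
  refine of_bound (fun i j => ?_) a (ha.mono fun z h i j => ?_)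
  · exact hF.aemeasurable_comp (g := fun M => star (M j i)) (by fun_prop)
  · rw [Matrix.conjTranspose_apply, norm_star]
    exact h j i

theorem of_continuous {F : Circle → Matrix (Fin p) (Fin q) ℂ}
    (hF : ∀ i j, Continuous fun z => F z i j) : IsEssBounded F := by
  have h1 : Continuous fun z => (fun i j => F z i j : Fin p → Fin q → ℂ) :=
    continuous_pi fun i => continuous_pi fun j => hF i j
  obtain ⟨K, hK⟩ := isCompact_univ.exists_bound_of_continuousOn h1.continuousOn
  refine of_bound (fun i j => ((hF i j).comp Circle.exp.continuous).measurable.aemeasurable) K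
    (Filter.Eventually.of_forall fun θ i j => ?_)
  exact ((norm_le_pi_norm _ j).trans (norm_le_pi_norm
    (fun i j => F (Circle.exp θ) i j : Fin p → Fin q → ℂ) i)).trans (hK _ (Set.mem_univ _))

theorem const (M : Matrix (Fin p) (Fin q) ℂ) : IsEssBounded fun _ => M :=
  of_continuous fun _ _ => continuous_const

theorem integrable_apply {F : Circle → Matrix (Fin p) (Fin q) ℂ} (hF : IsEssBounded F)
    (i : Fin p) (j : Fin q) : Integrable (fun θ : ℝ => F (Circle.exp θ) i j) angleMeasure := by
  obtain ⟨a, -, ha⟩ := hF.2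
  exact Integrable.of_bound (hF.1 i j).aestronglyMeasurable a (ha.mono fun z h => h i j)

theorem integrable_re_trace {F : Circle → Matrix (Fin p) (Fin p) ℂ} (hF : IsEssBounded F) :
    Integrable (fun θ : ℝ => (F (Circle.exp θ)).trace.re) angleMeasure := by
  have h : Integrable (fun θ : ℝ => (F (Circle.exp θ)).trace) angleMeasure :=
    integrable_finsetSum _ fun i _ => hF.integrable_apply i i
  exact h.re

theorem inv {F : Circle → Matrix (Fin p) (Fin p) ℂ} (hF : IsEssBounded F) {α : ℝ} (hα : 0 < α)
    (h : AECircle fun z => (F z - (α : ℂ) • (1 : Matrix (Fin p) (Fin p) ℂ)).PosDef) :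
    IsEssBounded fun z => (F z)⁻¹ := by
  refine of_bound (fun i j => ?_) α⁻¹ (h.mono fun z hz => Matrix.norm_inv_apply_le hα hz)
  have h1 : (fun θ : ℝ => (F (Circle.exp θ))⁻¹ i j) = fun θ : ℝ =>
      ((F (Circle.exp θ)).det)⁻¹ * (F (Circle.exp θ)).adjugate i j := by
    ext θ
    rw [Matrix.inv_def, Ring.inverse_eq_inv', Matrix.smul_apply, smul_eq_mul]
  rw [h1]
  exact (hF.aemeasurable_comp (g := Matrix.det) (by fun_prop)).inv.mul
    (hF.aemeasurable_comp (g := fun M => M.adjugate i j)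
      (Continuous.matrix_elem (Continuous.matrix_adjugate continuous_id) i j))

end IsEssBounded

/-! ## Spectral densities -/

theorem Matrix.map_conj_inv {p : ℕ} (M : Matrix (Fin p) (Fin p) ℂ) :
    (M⁻¹).map (starRingEnd ℂ) = (M.map (starRingEnd ℂ))⁻¹ := by
  have h : ∀ N : Matrix (Fin p) (Fin p) ℂ, N.map (starRingEnd ℂ) = Nᴴᵀ := fun N => rfl
  rw [h, h, Matrix.conjTranspose_nonsing_inv, Matrix.transpose_nonsing_inv]

namespace IsSpectralDensity

variable {m : ℕ} {Φ : Circle → Matrix (Fin m) (Fin m) ℂ}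

theorem posDef (h : IsSpectralDensity Φ) : AECircle fun z => (Φ z).PosDef := by
  obtain ⟨α, hα, h1⟩ := h.coercive
  exact h1.mono fun z hz => Matrix.posDef_of_sub_smul_one hα.le hz

theorem isEssBounded (h : IsSpectralDensity Φ) : IsEssBounded Φ := by
  obtain ⟨c, hc⟩ := h.bounded
  refine IsEssBounded.of_bound h.measurable c ((h.posDef.and hc).mono fun z hz i j => ?_)
  refine hz.1.posSemidef.norm_apply_le (fun i => ?_) i j
  have h1 := (Complex.nonneg_iff.1 (hz.2.diag_nonneg (i := i))).1
  simp at h1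
  exact h1

theorem isEssBounded_inv (h : IsSpectralDensity Φ) : IsEssBounded fun z => (Φ z)⁻¹ := by
  obtain ⟨α, hα, h1⟩ := h.coercive
  exact h.isEssBounded.inv hα h1

/-- The integrand of the relative entropy rate is integrable. -/
theorem integrable_rerDist {Ψ : Circle → Matrix (Fin m) (Fin m) ℂ} (hΦ : IsSpectralDensity Φ)
    (hΨ : IsSpectralDensity Ψ) : Integrable (fun θ : ℝ =>
      Real.log (((Φ (Circle.exp θ))⁻¹ * Ψ (Circle.exp θ)).det).re +
        (((Ψ (Circle.exp θ))⁻¹ * (Φ (Circle.exp θ) - Ψ (Circle.exp θ))).trace).re)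
      angleMeasure := by
  refine Integrable.add ?_
    (hΨ.isEssBounded_inv.mul (hΦ.isEssBounded.sub hΨ.isEssBounded)).integrable_re_trace
  have h1 := hΦ.isEssBounded_inv.mul hΨ.isEssBounded
  have h2 := hΨ.isEssBounded_inv.mul hΦ.isEssBounded
  obtain ⟨K, -, hK⟩ := h1.2
  obtain ⟨L, -, hL⟩ := h2.2
  refine Integrable.of_bound ?_ (m.factorial * K ^ m + m.factorial * L ^ m) ?_
  · have h3 := h1.aemeasurable_comp (g := Matrix.det) (by fun_prop)
    exact (Real.measurable_log.comp_aemeasurable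
      (Complex.measurable_re.comp_aemeasurable h3)).aestronglyMeasurable
  · exact ((hΦ.posDef.and hΨ.posDef).and (hK.and hL)).mono fun z hz =>
      hz.1.1.abs_log_det_inv_mul_le hz.1.2 (Matrix.norm_det_le hz.2.1) (Matrix.norm_det_le hz.2.2)

end IsSpectralDensity

/-! ## The space of perturbations of spectral densities -/

/-- Bounded Hermitian matrix functions on the circle with the symmetry of real processes. -/
def perturbationSpace (m : ℕ) : Submodule ℝ (Circle → Matrix (Fin m) (Fin m) ℂ) where
  carrier := {F | IsEssBounded F ∧ (AECircle fun z => (F z).IsHermitian) ∧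
    AECircle fun z => F z⁻¹ = (F z).map (starRingEnd ℂ)}
  add_mem' {F K} hF hK := by
    refine ⟨hF.1.add hK.1, (hF.2.1.and hK.2.1).mono fun z h => h.1.add h.2,
      (hF.2.2.and hK.2.2).mono fun z h => ?_⟩
    rw [Pi.add_apply, Pi.add_apply, h.1, h.2]
    ext i j
    simp
  zero_mem' := ⟨IsEssBounded.const 0, Filter.Eventually.of_forall fun _ => Matrix.isHermitian_zero,
    Filter.Eventually.of_forall fun _ => by ext i j; simp⟩
  smul_mem' c F hF := by
    refine ⟨hF.1.smul c, hF.2.1.mono fun z h => ?_, hF.2.2.mono fun z h => ?_⟩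
    · rw [Pi.smul_apply, Matrix.IsHermitian, Matrix.conjTranspose_smul, h.eq]
      simp
    · rw [Pi.smul_apply, Pi.smul_apply, h]
      ext i j
      simp

theorem IsSpectralDensity.mem_perturbationSpace {m : ℕ} {Φ : Circle → Matrix (Fin m) (Fin m) ℂ}
    (h : IsSpectralDensity Φ) : Φ ∈ perturbationSpace m :=
  ⟨h.isEssBounded, h.posDef.mono fun _ h => h.1, h.real⟩

theorem IsSpectralDensity.inv_mem_perturbationSpace {m : ℕ}
    {Φ : Circle → Matrix (Fin m) (Fin m) ℂ} (h : IsSpectralDensity Φ) :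
    (fun z => (Φ z)⁻¹) ∈ perturbationSpace m :=
  ⟨h.isEssBounded_inv, h.posDef.mono fun _ h => h.1.inv, h.real.mono fun z hz => by
    simp only [hz, Matrix.map_conj_inv]⟩

/-- The form `∫ tr (F K)` on bounded Hermitian matrix functions. -/
def traceForm (m : ℕ) : LinearMap.BilinForm ℝ (perturbationSpace m) :=
  LinearMap.mk₂ ℝ (fun F K => ∫ θ, ((F.1 (Circle.exp θ) * K.1 (Circle.exp θ)).trace).re
      ∂angleMeasure)
    (fun F F' K => by
      rw [← integral_add (F.2.1.mul K.2.1).integrable_re_trace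
        (F'.2.1.mul K.2.1).integrable_re_trace]
      simp [Matrix.add_mul])
    (fun c F K => by
      rw [smul_eq_mul, ← integral_const_mul]
      simp)
    (fun F K K' => by
      rw [← integral_add (F.2.1.mul K.2.1).integrable_re_trace
        (F.2.1.mul K'.2.1).integrable_re_trace]
      simp [Matrix.mul_add])
    (fun c F K => by
      rw [smul_eq_mul, ← integral_const_mul]
      simp)

theorem traceForm_apply {m : ℕ} (F K : perturbationSpace m) : traceForm m F K =
    ∫ θ, ((F.1 (Circle.exp θ) * K.1 (Circle.exp θ)).trace).re ∂angleMeasure := rfl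

theorem traceForm_comm {m : ℕ} (F K : perturbationSpace m) :
    traceForm m F K = traceForm m K F := by
  rw [traceForm_apply, traceForm_apply]
  exact integral_congr_ae (Filter.Eventually.of_forall fun θ =>
    congrArg Complex.re (Matrix.trace_mul_comm _ _))

theorem aeCircle_re_trace_mul_self_nonneg {m : ℕ} (F : perturbationSpace m) :
    AECircle fun z => 0 ≤ ((F.1 z * F.1 z).trace).re := by
  refine F.2.2.1.mono fun z h => ?_
  have h1 := (Matrix.posSemidef_conjTranspose_mul_self (F.1 z)).trace_nonneg
  rw [h.eq] at h1
  exact (Complex.nonneg_iff.1 h1).1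

theorem traceForm_self_nonneg {m : ℕ} (F : perturbationSpace m) : 0 ≤ traceForm m F F :=
  integral_nonneg_of_ae (aeCircle_re_trace_mul_self_nonneg F)

/-- The integrand is `tr (Fᴴ F) ≥ 0`. Elements are functions, not classes, so vanishing holds only
almost everywhere. -/
theorem aeCircle_eq_zero_of_traceForm_self {m : ℕ} {F : perturbationSpace m}
    (h : traceForm m F F = 0) : AECircle fun z => F.1 z = 0 := by
  rw [traceForm_apply, integral_eq_zero_iff_of_nonneg_ae (aeCircle_re_trace_mul_self_nonneg F)
    (F.2.1.mul F.2.1).integrable_re_trace] at h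
  have h' : AECircle fun z => ((F.1 z * F.1 z).trace).re = 0 := h
  refine (h'.and F.2.2.1).mono fun z hz => ?_
  have h1 := (Matrix.posSemidef_conjTranspose_mul_self (F.1 z)).trace_nonneg
  rw [← Matrix.trace_conjTranspose_mul_self_eq_zero_iff]
  refine Complex.ext ?_ (Complex.nonneg_iff.1 h1).2.symm
  rw [hz.2.eq, hz.1]
  rfl

/-! ## The adjoint of the moment map -/

theorem isEssBounded_transferFunction {n m : ℕ} {A : Matrix (Fin n) (Fin n) ℝ}
    (hA : ∀ a : ℂ, (A.map Complex.ofReal).charpoly.IsRoot a → ‖a‖ < 1)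
    (B : Matrix (Fin n) (Fin m) ℝ) : IsEssBounded (onCircle (transferFunction A B)) := by
  have hG : onCircle (transferFunction A B) = fun z : Circle =>
      (Matrix.scalar (Fin n) (z : ℂ) - A.map Complex.ofReal)⁻¹ * B.map Complex.ofReal :=
    funext fun z => (onCircle_transferFunction hA B z).2
  rw [hG]
  refine IsEssBounded.mul (IsEssBounded.of_continuous fun i j => ?_) (IsEssBounded.const _)
  have hc : Continuous fun z : Circle =>
      Matrix.scalar (Fin n) (z : ℂ) - A.map Complex.ofReal := by
    refine Continuous.sub ?_ continuous_const
    exact Continuous.matrix_diagonal (continuous_pi fun _ => continuous_subtype_val)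
  simp_rw [Matrix.inv_def, Ring.inverse_eq_inv', Matrix.smul_apply, smul_eq_mul]
  exact (hc.matrix_det.inv₀ (det_scalar_sub_ne_zero hA)).mul (hc.matrix_adjugate.matrix_elem i j)

theorem map_conj_onCircle_transferFunction {n m : ℕ} {A : Matrix (Fin n) (Fin n) ℝ}
    (hA : ∀ a : ℂ, (A.map Complex.ofReal).charpoly.IsRoot a → ‖a‖ < 1)
    (B : Matrix (Fin n) (Fin m) ℝ) (z : Circle) : onCircle (transferFunction A B) z⁻¹ =
      (onCircle (transferFunction A B) z).map (starRingEnd ℂ) := by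
  rw [(onCircle_transferFunction hA B z).2, (onCircle_transferFunction hA B z⁻¹).2,
    Matrix.map_mul, Matrix.map_conj_inv]
  congr 1
  · congr 1
    ext i j
    by_cases h : i = j
    · subst h; simp [← Circle.coe_inv_eq_conj]
    · simp [h]
  · ext i j
    simp

section Moments

variable {n m : ℕ} {G : Circle → Matrix (Fin n) (Fin m) ℂ}

/-- The matrix functions `G* (Λ + Λᵀ) G`. -/
def momentAdjoint (hG : IsEssBounded G)
    (hr : ∀ z, G z⁻¹ = (G z).map (starRingEnd ℂ)) :
    Matrix (Fin n) (Fin n) ℝ →ₗ[ℝ] perturbationSpace m where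
  toFun Λ := ⟨fun z => (G z)ᴴ * (Λ + Λᵀ).map Complex.ofReal * G z,
    (hG.conjTranspose.mul (IsEssBounded.const _)).mul hG,
    Filter.Eventually.of_forall fun θ => by
      refine Matrix.isHermitian_conjTranspose_mul_mul _ ?_
      rw [Matrix.IsHermitian, conjTranspose_map_ofReal]
      ext i j
      simp [add_comm],
    Filter.Eventually.of_forall fun θ => by
      simp only [hr, Matrix.map_mul]
      congr 2
      ext i j
      simp⟩
  map_add' Λ M := Subtype.ext (funext fun z => by
    have h : (Λ + M + (Λ + M)ᵀ).map Complex.ofReal =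
        (Λ + Λᵀ).map Complex.ofReal + (M + Mᵀ).map Complex.ofReal := by
      ext i j
      simp
      ring
    change (G z)ᴴ * (Λ + M + (Λ + M)ᵀ).map Complex.ofReal * G z =
      (G z)ᴴ * (Λ + Λᵀ).map Complex.ofReal * G z + (G z)ᴴ * (M + Mᵀ).map Complex.ofReal * G z
    rw [h, Matrix.mul_add, Matrix.add_mul])
  map_smul' c Λ := Subtype.ext (funext fun z => by
    have h : (c • Λ + (c • Λ)ᵀ).map Complex.ofReal = c • (Λ + Λᵀ).map Complex.ofReal := by
      ext i j
      simp
    change (G z)ᴴ * (c • Λ + (c • Λ)ᵀ).map Complex.ofReal * G z =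
      c • ((G z)ᴴ * (Λ + Λᵀ).map Complex.ofReal * G z)
    rw [h, Matrix.mul_smul, Matrix.smul_mul])

theorem momentAdjoint_apply (hG : IsEssBounded G)
    (hr : ∀ z, G z⁻¹ = (G z).map (starRingEnd ℂ)) (Λ : Matrix (Fin n) (Fin n) ℝ) (z : Circle) :
    (momentAdjoint hG hr Λ).1 z = (G z)ᴴ * (Λ + Λᵀ).map Complex.ofReal * G z := rfl

/-- The moments of a perturbation orthogonal to all `G* (Λ + Λᵀ) G` vanish. -/
theorem circleMean_eq_zero_of_orthogonal (hG : IsEssBounded G)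
    (hr : ∀ z, G z⁻¹ = (G z).map (starRingEnd ℂ)) (D : perturbationSpace m)
    (hD : ∀ Λ, traceForm m D (momentAdjoint hG hr Λ) = 0) (i j : Fin n) :
    circleMean (fun z => (G z * D.1 z * (G z)ᴴ) i j) = 0 := by
  have hM : IsEssBounded fun z => G z * D.1 z * (G z)ᴴ := (hG.mul D.2.1).mul hG.conjTranspose
  have hint := hM.integrable_apply i j
  have hle : -Real.pi ≤ Real.pi := by linarith [Real.pi_pos]
  have hre : ∫ θ, ((G (Circle.exp θ) * D.1 (Circle.exp θ) * (G (Circle.exp θ))ᴴ) i j).re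
      ∂angleMeasure = 0 := by
    -- Symmetrizing the matrix unit pairs `D` with the sum of the entries `(i, j)` and `(j, i)`,
    -- which is twice a real part by Hermitian symmetry.
    have h1 := hD (Matrix.single i j 1)
    rw [traceForm_apply] at h1
    have h2 : (∫ θ, 2 * ((G (Circle.exp θ) * D.1 (Circle.exp θ) * (G (Circle.exp θ))ᴴ) i j).re
        ∂angleMeasure) = 0 := by
      rw [← h1]
      refine integral_congr_ae (Filter.Eventually.mono D.2.2.1 fun θ hz => ?_)
      simp only [momentAdjoint_apply]
      set z := Circle.exp θ
      have hH : (G z * D.1 z * (G z)ᴴ).IsHermitian := Matrix.isHermitian_mul_mul_conjTranspose _ hz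
      have h3 : (D.1 z * ((G z)ᴴ * (Matrix.single i j 1 + (Matrix.single i j (1 : ℝ))ᵀ).map
          Complex.ofReal * G z)).trace = (G z * D.1 z * (G z)ᴴ *
          (Matrix.single i j (1 : ℂ) + Matrix.single j i 1)).trace := by
        have h4 : (Matrix.single i j 1 + (Matrix.single i j (1 : ℝ))ᵀ).map Complex.ofReal =
            Matrix.single i j (1 : ℂ) + Matrix.single j i 1 := by
          ext k l
          simp [Matrix.single_apply, apply_ite Complex.ofReal, and_comm]
        rw [h4, ← Matrix.mul_assoc, Matrix.trace_mul_comm, ← Matrix.mul_assoc, ← Matrix.mul_assoc]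
      rw [h3, Matrix.mul_add, Matrix.trace_add, Matrix.trace_mul_single, Matrix.trace_mul_single]
      have h5 := congrArg Complex.re (hH.apply i j)
      rw [← starRingEnd_apply, Complex.conj_re] at h5
      simp [h5]
      ring
    rw [integral_const_mul] at h2
    simpa using h2
  -- Passing from `z` to `z⁻¹` conjugates the integrand, so its imaginary part is odd in `θ`.
  have him : ∫ θ, ((G (Circle.exp θ) * D.1 (Circle.exp θ) * (G (Circle.exp θ))ᴴ) i j).im
      ∂angleMeasure = 0 := by
    set f : ℝ → ℝ := fun θ =>
      ((G (Circle.exp θ) * D.1 (Circle.exp θ) * (G (Circle.exp θ))ᴴ) i j).im with hf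
    have h1 : ∫ θ in (-Real.pi)..Real.pi, f (-θ) = ∫ θ in (-Real.pi)..Real.pi, f θ := by
      rw [intervalIntegral.integral_comp_neg, neg_neg]
    have h2 : ∫ θ in (-Real.pi)..Real.pi, f (-θ) = ∫ θ in (-Real.pi)..Real.pi, -f θ := by
      rw [intervalIntegral.integral_of_le hle, intervalIntegral.integral_of_le hle]
      refine integral_congr_ae (Filter.Eventually.mono D.2.2.2 fun θ hz => ?_)
      simp only [hf]
      rw [Circle.exp_neg, hz, hr, ← Complex.conj_im]
      congr 1
      set z := Circle.exp θ
      have h3 : ((G z).map (starRingEnd ℂ))ᴴ = (G z)ᴴ.map (starRingEnd ℂ) := rfl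
      rw [h3, ← Matrix.map_mul, ← Matrix.map_mul, Matrix.map_apply]
    rw [intervalIntegral.integral_neg] at h2
    rw [← intervalIntegral.integral_of_le hle]
    linarith
  rw [circleMean, intervalIntegral.integral_of_le hle]
  have h : ∫ θ, (G (Circle.exp θ) * D.1 (Circle.exp θ) * (G (Circle.exp θ))ᴴ) i j
      ∂angleMeasure = 0 := by
    refine Complex.ext ?_ ?_
    · have h1 := integral_re hint
      exact h1.symm.trans hre
    · have h1 := integral_im hint
      exact h1.symm.trans him
  rw [h, mul_zero]

end Moments

/-! ## First-order optimality -/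

/-- Small perturbations of a coercive spectral density are uniformly coercive. -/
theorem IsSpectralDensity.exists_sub_smul {m : ℕ} {Φ : Circle → Matrix (Fin m) (Fin m) ℂ}
    (hΦ : IsSpectralDensity Φ) (D : perturbationSpace m) :
    ∃ t₀ : ℝ, 0 < t₀ ∧ ∃ α : ℝ, 0 < α ∧ ∀ t : ℝ, 0 < t → t ≤ t₀ →
      IsSpectralDensity (fun z => Φ z - t • D.1 z) ∧ AECircle fun z =>
        (Φ z - t • D.1 z - (α : ℂ) • (1 : Matrix (Fin m) (Fin m) ℂ)).PosDef := by
  obtain ⟨α, hα, hco⟩ := hΦ.coercive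
  obtain ⟨K, hK0, hK⟩ := D.2.1.2
  have hmK : 0 ≤ m * K := by positivity
  -- Entries bounded by `t K` give `t D ≤ m t K I ≤ (α / 2) I`, which leaves `α / 2` of the
  -- coercivity; the `+ 1` keeps the denominator positive.
  refine ⟨α / (2 * (m * K + 1)), by positivity, α / 2, by positivity, fun t ht htle => ?_⟩
  have ht2 : t * (m * K) ≤ α / 2 := by
    rw [le_div_iff₀ (by positivity)] at htle
    nlinarith
  have hcoer : AECircle fun z =>
      (Φ z - t • D.1 z - ((α / 2 : ℝ) : ℂ) • (1 : Matrix (Fin m) (Fin m) ℂ)).PosDef := by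
    refine (hco.and (hK.and D.2.2.1)).mono fun z hz => ?_
    have hH : (t • D.1 z).IsHermitian := by
      rw [Matrix.IsHermitian, Matrix.conjTranspose_smul, hz.2.2.eq]
      simp
    have h1 := hH.posSemidef_smul_one_sub (K := t * K) (c := α / 2) (fun i j => by
      rw [Matrix.smul_apply, norm_smul, Real.norm_eq_abs, abs_of_pos ht]
      exact mul_le_mul_of_nonneg_left (hz.2.1 i j) ht.le) (by positivity) (by linarith)
    have h2 := hz.1.add_posSemidef h1
    have h3 : Φ z - t • D.1 z - ((α / 2 : ℝ) : ℂ) • (1 : Matrix (Fin m) (Fin m) ℂ) =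
        Φ z - (α : ℂ) • 1 + (((α / 2 : ℝ) : ℂ) • 1 - t • D.1 z) := by
      have h4 : (α : ℂ) = ((α / 2 : ℝ) : ℂ) + ((α / 2 : ℝ) : ℂ) := by
        push_cast
        ring
      rw [h4, add_smul]
      abel
    rwa [h3]
  have hmem := sub_mem hΦ.mem_perturbationSpace
    ((perturbationSpace m).smul_mem t D.2)
  refine ⟨⟨hmem.1.1, hmem.2.2, ?_, α / 2, by positivity, hcoer⟩, hcoer⟩
  obtain ⟨L, hL0, hL⟩ := hmem.1.2
  exact ⟨m * L, (hL.and hmem.2.1).mono fun z hz =>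
    hz.2.posSemidef_smul_one_sub hz.1 hL0 le_rfl⟩

/-- Second-order expansion of the integrand of the relative entropy rate. -/
theorem rerDist_integrand_sub_le {m : ℕ} {P Q R D : Matrix (Fin m) (Fin m) ℂ} {t : ℝ}
    (hP : P.PosDef) (hQ : Q.PosDef) (hR : R.PosDef) (hPQ : P = Q - t • D) :
    Real.log ((P⁻¹ * R).det).re + ((R⁻¹ * (P - R)).trace).re -
      (Real.log ((Q⁻¹ * R).det).re + ((R⁻¹ * (Q - R)).trace).re) ≤
      -t * (((R⁻¹ - Q⁻¹) * D).trace).re + t ^ 2 * ((P⁻¹ * D * (Q⁻¹ * D)).trace).re := by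
  have hPu : IsUnit P.det := isUnit_iff_ne_zero.2 hP.det_pos.ne'
  have hQu : IsUnit Q.det := isUnit_iff_ne_zero.2 hQ.det_pos.ne'
  have h1 := hP.log_det_inv_mul_le hQ hR
  have h2 : Q = P + t • D := by rw [hPQ]; abel
  have h3 : P⁻¹ * Q = 1 + t • (P⁻¹ * D) := by
    conv_lhs => rw [h2]
    rw [Matrix.mul_add, Matrix.nonsing_inv_mul _ hPu, Matrix.mul_smul]
  -- The resolvent identity moves `P⁻¹` into the quadratic term, where a bound uniform in `t` is
  -- enough.
  have h4 : P⁻¹ = Q⁻¹ + t • (P⁻¹ * D * Q⁻¹) := by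
    have h5 := congrArg (· * Q⁻¹) h3
    rwa [Matrix.mul_nonsing_inv_cancel_right _ _ hQu, Matrix.add_mul, Matrix.one_mul,
      Matrix.smul_mul] at h5
  have h5 : ((P⁻¹ * Q).trace).re = m + t * ((P⁻¹ * D).trace).re := by
    rw [h3, Matrix.trace_add, Matrix.trace_one, Matrix.trace_smul]
    simp
  have h6 : ((P⁻¹ * D).trace).re = ((Q⁻¹ * D).trace).re +
      t * ((P⁻¹ * D * (Q⁻¹ * D)).trace).re := by
    conv_lhs => rw [h4]
    rw [Matrix.add_mul, Matrix.trace_add, Matrix.smul_mul, Matrix.trace_smul, Matrix.mul_assoc _ Q⁻¹]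
    simp
  have h7 : ((R⁻¹ * (P - R)).trace).re = ((R⁻¹ * (Q - R)).trace).re -
      t * ((R⁻¹ * D).trace).re := by
    have h8 : P - R = Q - R - t • D := by rw [hPQ]; abel
    rw [h8, Matrix.mul_sub, Matrix.mul_smul, Matrix.trace_sub, Matrix.trace_smul]
    simp
  have h9 : (((R⁻¹ - Q⁻¹) * D).trace).re = ((R⁻¹ * D).trace).re - ((Q⁻¹ * D).trace).re := by
    rw [Matrix.sub_mul, Matrix.trace_sub, Complex.sub_re]
  rw [h5, h6] at h1
  rw [h7, h9]
  linarith

/-- The first variation of the relative entropy rate in a direction that stays feasible. -/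
theorem integral_first_variation_nonpos {m : ℕ} {Φ Ψ : Circle → Matrix (Fin m) (Fin m) ℂ}
    (hΦ : IsSpectralDensity Φ) (hΨ : IsSpectralDensity Ψ) (D : perturbationSpace m)
    (hmin : ∀ t : ℝ, IsSpectralDensity (fun z => Φ z - t • D.1 z) →
      rerDist Φ Ψ ≤ rerDist (fun z => Φ z - t • D.1 z) Ψ) :
    ∫ θ, ((((Ψ (Circle.exp θ))⁻¹ - (Φ (Circle.exp θ))⁻¹) * D.1 (Circle.exp θ)).trace).re
      ∂angleMeasure ≤ 0 := by
  obtain ⟨t₀, ht₀, α, hα, hpert⟩ := hΦ.exists_sub_smul D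
  obtain ⟨K, hK0, hK⟩ := D.2.1.2
  obtain ⟨L, hL0, hL⟩ := (hΦ.isEssBounded_inv.mul D.2.1).2
  set c := ∫ θ, ((((Ψ (Circle.exp θ))⁻¹ - (Φ (Circle.exp θ))⁻¹) * D.1 (Circle.exp θ)).trace).re
    ∂angleMeasure with hc
  have hint := ((hΨ.isEssBounded_inv.sub hΦ.isEssBounded_inv).mul D.2.1).integrable_re_trace
  -- Bounds the trace of `(P⁻¹ D) (Φ⁻¹ D)`: `α⁻¹` for `P⁻¹`, `K` for `D`, `L` for `Φ⁻¹ D`, and a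
  -- factor `m` for each of the two products and the trace.
  set C : ℝ := m * (m * (m * (α⁻¹ * K) * L)) with hC
  have hC0 : 0 ≤ C := by positivity
  set V : ℝ := angleMeasure.real Set.univ with hV
  have hV0 : 0 ≤ V := measureReal_nonneg
  have hle : -Real.pi ≤ Real.pi := by linarith [Real.pi_pos]
  have key : ∀ t : ℝ, 0 < t → t ≤ t₀ → c ≤ t * (V * C) := by
    intro t ht htle
    obtain ⟨hP, hPco⟩ := hpert t ht htle
    have h1 := hmin t hP
    rw [rerDist, rerDist, mul_le_mul_iff_right₀ (by positivity),
      intervalIntegral.integral_of_le hle, intervalIntegral.integral_of_le hle, ← sub_nonneg,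
      ← integral_sub (hP.integrable_rerDist hΨ) (hΦ.integrable_rerDist hΨ)] at h1
    have h2 := h1.trans (integral_mono_ae
      ((hP.integrable_rerDist hΨ).sub (hΦ.integrable_rerDist hΨ))
      ((hint.const_mul (-t)).add (integrable_const (t ^ 2 * C)))
      (Filter.Eventually.mono ((hPco.and (hP.posDef.and hΦ.posDef)).and (hΨ.posDef.and
        (hK.and hL))) fun θ hθ => ?_))
    · rw [integral_add' (hint.const_mul (-t)) (integrable_const _), integral_const_mul,
        integral_const, smul_eq_mul] at h2
      have h3 : t * c ≤ t * (t * (V * C)) := by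
        rw [← hc, ← hV] at h2
        linarith
      exact le_of_mul_le_mul_left h3 ht
    · obtain ⟨⟨h3, h4, h5⟩, h6, h7, h8⟩ := hθ
      refine (rerDist_integrand_sub_le h4 h5 h6 rfl).trans ?_
      simp only [Pi.add_apply]
      refine add_le_add le_rfl (mul_le_mul_of_nonneg_left ?_ (sq_nonneg t))
      exact (Complex.re_le_norm _).trans (Matrix.norm_trace_le (Matrix.norm_mul_apply_le
        (Matrix.norm_mul_apply_le (Matrix.norm_inv_apply_le hα h3) h7) h8))
  by_contra! hpos
  -- If `c > 0`, this `t` makes the quadratic term so small that `c ≤ c / 2`.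
  have h1 := key (min t₀ (c / (2 * (V * C + 1)))) (lt_min ht₀ (by positivity)) (min_le_left _ _)
  have h2 : min t₀ (c / (2 * (V * C + 1))) * (V * C) ≤ c / (2 * (V * C + 1)) * (V * C) :=
    mul_le_mul_of_nonneg_right (min_le_right _ _) (by positivity)
  have h3 : c / (2 * (V * C + 1)) * (V * C) ≤ c / 2 := by
    rw [div_mul_eq_mul_div, div_le_div_iff₀ (by positivity) (by positivity)]
    nlinarith
  linarith

/-- Solutions of the spectrum approximation problem have the form `[Ψ⁻¹ + G* Λ G]⁻¹`. -/
theorem IsOptimalApproximant.exists_multiplier {n m : ℕ} {G : Circle → Matrix (Fin n) (Fin m) ℂ}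
    (hG : IsEssBounded G) (hr : ∀ z, G z⁻¹ = (G z).map (starRingEnd ℂ))
    {S : Matrix (Fin n) (Fin n) ℝ} {Ψ Φ : Circle → Matrix (Fin m) (Fin m) ℂ}
    (hΨ : IsSpectralDensity Ψ) (h : IsOptimalApproximant G S Ψ Φ) :
    ∃ Λ : Matrix (Fin n) (Fin n) ℝ, IsMultiplier G Ψ Λ ∧
      AECircle fun z => Φ z = approximant G Ψ Λ z := by
  have hΦ := h.spectral
  let H : perturbationSpace m := ⟨_, hΨ.inv_mem_perturbationSpace⟩ -
    ⟨_, hΦ.inv_mem_perturbationSpace⟩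
  obtain ⟨M, hM⟩ := LinearMap.BilinForm.exists_forall_sub_apply_eq_zero (traceForm m)
    traceForm_self_nonneg traceForm_comm (momentAdjoint hG hr) H
  set D := H - momentAdjoint hG hr M with hD
  have hmom := circleMean_eq_zero_of_orthogonal hG hr D hM
  have hvar := integral_first_variation_nonpos hΦ hΨ D fun t ht => by
    refine h.minimal _ ht fun i j => ?_
    have h1 := (((hG.mul hΦ.isEssBounded).mul hG.conjTranspose).integrable_apply i j)
    have h2 := (((hG.mul D.2.1).mul hG.conjTranspose).integrable_apply i j)
    have hle : -Real.pi ≤ Real.pi := by linarith [Real.pi_pos]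
    have h3 := h.moment i j
    have h4 := hmom i j
    rw [circleMean, intervalIntegral.integral_of_le hle] at h3 h4 ⊢
    have h5 : ∀ z, (G z * (Φ z - t • D.1 z) * (G z)ᴴ) i j =
        (G z * Φ z * (G z)ᴴ) i j - (t : ℂ) * (G z * D.1 z * (G z)ᴴ) i j := by
      intro z
      rw [Matrix.mul_sub, Matrix.sub_mul, Matrix.mul_smul, Matrix.smul_mul]
      simp
    simp_rw [h5]
    rw [integral_sub h1 (h2.const_mul _), integral_const_mul, mul_sub, h3,
      mul_left_comm, h4, mul_zero, sub_zero]
  have hHD : traceForm m H D ≤ 0 := hvar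
  -- `H - D` lies in the range of `momentAdjoint`, to which `D` is orthogonal; hence `⟨D, D⟩ = ⟨H,
  -- D⟩ ≤ 0`.
  have hDD : traceForm m D D = 0 := by
    refine le_antisymm ?_ (traceForm_self_nonneg D)
    have h1 : traceForm m H D = traceForm m D D + traceForm m (momentAdjoint hG hr M) D := by
      rw [← LinearMap.add_apply, ← map_add, hD, sub_add_cancel]
    rw [traceForm_comm (momentAdjoint hG hr M), hM, add_zero] at h1
    rwa [← h1]
  have hkey : AECircle fun z => inverseApproximant G Ψ (-(M + Mᵀ)) z = (Φ z)⁻¹ := by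
    refine (aeCircle_eq_zero_of_traceForm_self hDD).mono fun z hz => ?_
    have h1 : D.1 z = (Ψ z)⁻¹ - (Φ z)⁻¹ - (G z)ᴴ * (M + Mᵀ).map Complex.ofReal * G z := rfl
    rw [h1] at hz
    have h2 : (-(M + Mᵀ)).map Complex.ofReal = -((M + Mᵀ).map Complex.ofReal) := by
      ext i j
      simp
    rw [inverseApproximant, h2, Matrix.mul_neg, Matrix.neg_mul, ← sub_eq_zero, ← hz]
    abel
  refine ⟨-(M + Mᵀ), ⟨?_, (hkey.and hΦ.posDef).mono fun z hz => ?_⟩,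
    (hkey.and hΦ.posDef).mono fun z hz => ?_⟩
  · rw [Matrix.IsSymm, Matrix.transpose_neg, Matrix.transpose_add, Matrix.transpose_transpose,
      add_comm]
  · rw [hz.1]
    exact hz.2.inv
  · rw [approximant, hz.1, Matrix.nonsing_inv_nonsing_inv _ (isUnit_iff_ne_zero.2 hz.2.det_pos.ne')]

end

/-! ### Degree of the filter and rationality of the approximants -/

theorem mainTheorem5 {n m : ℕ} (A : Matrix (Fin n) (Fin n) ℝ) (B : Matrix (Fin n) (Fin m) ℝ)
    (hAB : IsFilterBank A B)
    (Ψ : Matrix (Fin m) (Fin m) (RatFunc ℂ)) (hΨ : IsSpectralDensity (onCircle Ψ)) :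
    mcmillanDegree (transferFunction A B) = n ∧
    (∀ Λ : Matrix (Fin n) (Fin n) ℝ,
      IsMultiplier (onCircle (transferFunction A B)) (onCircle Ψ) Λ →
        IsRationalOfDegreeLE (approximant (onCircle (transferFunction A B)) (onCircle Ψ) Λ)
          (mcmillanDegree Ψ + 2 * n)) ∧
    (∀ (S : Matrix (Fin n) (Fin n) ℝ) (Φ : Circle → Matrix (Fin m) (Fin m) ℂ), S.PosDef →
      IsOptimalApproximant (onCircle (transferFunction A B)) S (onCircle Ψ) Φ →
        (∃ Λ : Matrix (Fin n) (Fin n) ℝ,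
          IsMultiplier (onCircle (transferFunction A B)) (onCircle Ψ) Λ ∧
          AECircle fun z => Φ z =
            approximant (onCircle (transferFunction A B)) (onCircle Ψ) Λ z) ∧
        IsRationalOfDegreeLE Φ (mcmillanDegree Ψ + 2 * n)) := by
  have hrat := fun Λ hΛ => isRationalOfDegreeLE_approximant (Λ := Λ) hAB.stable B hΨ.posDef hΛ
  refine ⟨mcmillanDegree_transferFunction hAB.reachable, hrat, fun S Φ _ hΦ => ?_⟩
  obtain ⟨Λ, hΛ, hΦΛ⟩ := hΦ.exists_multiplier (isEssBounded_transferFunction hAB.stable B)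
    (map_conj_onCircle_transferFunction hAB.stable B) hΨ
  obtain ⟨P, hP, hdeg⟩ := hrat Λ hΛ
  exact ⟨⟨Λ, hΛ, hΦΛ⟩, P, (hΦΛ.and hP).mono fun z hz => hz.1.trans hz.2, hdeg⟩
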